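/- Let $M$ be a smooth $4$-manifold with a smooth Lorentzian metric $g$ of signature $(-+++)$, oriented by its metric volume element $\eta$. Let $\nabla$ be the Levi-Civita connection, $d$ the exterior derivative, and $*$ the Hodge dual, with $(*A)_{\alpha\beta}=\frac12\eta_{\alpha\beta\mu\nu}A^{\mu\nu}$ on $2$-forms and $(*\omega)_\beta=\frac1{3!}\omega^{\mu\nu\rho}\eta_{\mu\nu\rho\beta}$ on $3$-forms. Let $\delta=*d*$ be the codifferential on $2$-forms, so that $(\delta A)_\beta=-\nabla^\alpha A_{\alpha\beta}$, and put $(i(v)A)_\beta=v^\alpha A_{\alpha\beta}$ for a $1$-form $v$ (index raised with $g$), and similarly $i(v)$ contracts the first index of any tensor; all these operations are extended complex-linearly. Let $A$ be a non-null skew-symmetric tensor with canonical elements $(U,\phi,\psi)$, that is, $$A=e^{\phi}\,[\cos\psi\,U+\sin\psi\,{*U}],$$ where $\phi,\psi$ are smooth real functions on $M$ and $U$ is a smooth unitary $2$-form: at each point, $U$ is the volume element of a time-like $2$-plane, i.e. $U=t\wedge s$, $U_{\alpha\beta}=t_\alpha s_\beta-t_\beta s_\alpha$, for some vectors $t,s$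 with $g(t,t)=-1$, $g(s,s)=1$, $g(t,s)=0$. (Any $A$ of this form is non-null.) Put $$\mathcal U=\tfrac1{\sqrt2}(U-\mathrm i\,{*U}),\qquad \mathcal G_{\alpha\beta\mu\nu}=\tfrac12\big(g_{\alpha\mu}g_{\beta\nu}-g_{\alpha\nu}g_{\beta\mu}-\mathrm i\,\eta_{\alpha\beta\mu\nu}\big).$$ Then $A$ satisfies the conformal Killing-Yano equation $$\nabla_{(\alpha}A_{\beta)\mu}=g_{\alpha\beta}\,a_\mu-a_{(\alpha}g_{\beta)\mu},\qquad 3a=-\delta A,$$ (round brackets denote symmetrization with factor $\frac12$) on $M$ if and only if the following three equations hold on $M$: $$\Sigma[U]\equiv\nabla\mathcal U-i(\delta\mathcal U)\,\mathcal U\otimes\mathcal U-i(\delta\mathcal U)\,\mathcal G=0,$$ $$-2\,d\phi=\Phi[U]\equiv i(\delta U)U-i(\delta{*U}){*U},$$ $$-2\,d\psi=\Psi[U]\equiv-i(\delta U){*U}-i(\delta{*U})U.$$ -/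

import Mathlib

open scoped Manifold ContDiff

noncomputable section

/-- The model space of a four-dimensional manifold. -/
abbrev E4 : Type := EuclideanSpace ℝ (Fin 4)

/-! ### Tensor calculus in a coordinate domain

All tensors are given by their covariant components. A tensor field on a coordinate domain is a
function of the coordinates `y : E4`; the values lie in `F = ℝ` or `F = ℂ`. The parameter `g` is
the field of matrices `g_{ij}` of the metric and `η` the field of components of the metric volume
element. -/

namespace Coord

variable {F : Type} [NormedField F] [NormedAlgebra ℝ F]

/-- The partial derivative `∂_k f` at `y`. -/
def pd (k : Fin 4) (f : E4 → F) (y : E4) : F :=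
  fderiv ℝ f y (EuclideanSpace.single k (1 : ℝ))

/-- The Christoffel symbol `Γ^k_{ij}` of the Levi-Civita connection. -/
def christoffel (g : E4 → Matrix (Fin 4) (Fin 4) ℝ) (y : E4) (k i j : Fin 4) : ℝ :=
  (1 / 2) * ∑ l, (g y)⁻¹ k l *
    (pd i (fun z => g z j l) y + pd j (fun z => g z i l) y - pd l (fun z => g z i j) y)

/-- The covariant derivative `∇_k T_{ij}` of a twice covariant tensor field. -/
def nabla (g : E4 → Matrix (Fin 4) (Fin 4) ℝ) (T : E4 → Fin 4 → Fin 4 → F)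
    (y : E4) (k i j : Fin 4) : F :=
  pd k (fun z => T z i j) y
    - ∑ l, christoffel g y l k i • T y l j - ∑ l, christoffel g y l k j • T y i l

/-- The Hodge dual of a 2-form, `(*A)_{ij} = (1/2) η_{ijkl} A^{kl}`. -/
def star (g : E4 → Matrix (Fin 4) (Fin 4) ℝ) (η : E4 → Fin 4 → Fin 4 → Fin 4 → Fin 4 → ℝ)
    (A : E4 → Fin 4 → Fin 4 → F) (y : E4) (i j : Fin 4) : F :=
  (1 / 2 : ℝ) • ∑ k, ∑ l, η y i j k l • ∑ m, ∑ n, ((g y)⁻¹ k m * (g y)⁻¹ l n) • A y m n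

/-- The exterior derivative of a 2-form, `(dB)_{ijk} = ∂_i B_{jk} + ∂_j B_{ki} + ∂_k B_{ij}`. -/
def extd (B : E4 → Fin 4 → Fin 4 → F) (y : E4) (i j k : Fin 4) : F :=
  pd i (fun z => B z j k) y + pd j (fun z => B z k i) y + pd k (fun z => B z i j) y

/-- The Hodge dual of a 3-form, `(*W)_l = (1/3!) W^{ijk} η_{ijkl}`. -/
def star3 (g : E4 → Matrix (Fin 4) (Fin 4) ℝ) (η : E4 → Fin 4 → Fin 4 → Fin 4 → Fin 4 → ℝ)
    (W : E4 → Fin 4 → Fin 4 → Fin 4 → F) (y : E4) (l : Fin 4) : F :=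
  (1 / 6 : ℝ) • ∑ i, ∑ j, ∑ k, η y i j k l •
    ∑ a, ∑ b, ∑ c, ((g y)⁻¹ i a * (g y)⁻¹ j b * (g y)⁻¹ k c) • W y a b c

/-- The exterior codifferential `δ = * d *` on 2-forms. In signature `(-+++)`, with the above
conventions, `(δA)_j = - ∇^i A_{ij}`. -/
def codiff (g : E4 → Matrix (Fin 4) (Fin 4) ℝ) (η : E4 → Fin 4 → Fin 4 → Fin 4 → Fin 4 → ℝ)
    (A : E4 → Fin 4 → Fin 4 → F) (y : E4) (j : Fin 4) : F :=
  star3 g η (extd (star g η A)) y j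

/-- The interior product `(i(v)A)_j = v^i A_{ij}`, the index of the 1-form `v` being raised with
the inverse metric `h` (all at one point). -/
def interior (h : Matrix (Fin 4) (Fin 4) ℝ) (v : Fin 4 → F) (A : Fin 4 → Fin 4 → F)
    (j : Fin 4) : F :=
  ∑ i, (∑ a, h i a • v a) * A i j

/-- The self-dual 2-form `(1/√2) (U - i *U)` associated with a real 2-form `U`. -/
def selfDual (g : E4 → Matrix (Fin 4) (Fin 4) ℝ) (η : E4 → Fin 4 → Fin 4 → Fin 4 → Fin 4 → ℝ)
    (U : E4 → Fin 4 → Fin 4 → ℝ) (y : E4) (i j : Fin 4) : ℂ :=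
  (1 / (Real.sqrt 2 : ℂ)) * ((U y i j : ℂ) - Complex.I * ((star g η U y i j : ℝ) : ℂ))

/-- The metric `𝒢 = (1/2) (G - i η)` on the self-dual 2-forms, where
`G_{ijkl} = g_{ik} g_{jl} - g_{il} g_{jk}` is the metric on the 2-forms. -/
def selfDualMetric (g : E4 → Matrix (Fin 4) (Fin 4) ℝ)
    (η : E4 → Fin 4 → Fin 4 → Fin 4 → Fin 4 → ℝ) (y : E4) (i j k l : Fin 4) : ℂ :=
  (1 / 2 : ℂ) *
    (((g y i k * g y j l - g y i l * g y j k : ℝ) : ℂ) - Complex.I * (η y i j k l : ℂ))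

/-- `Σ[U] = ∇𝒰 - i(δ𝒰)𝒰 ⊗ 𝒰 - i(δ𝒰)𝒢`, where `𝒰` is the self-dual 2-form associated
with `U`. -/
def sigma (g : E4 → Matrix (Fin 4) (Fin 4) ℝ) (η : E4 → Fin 4 → Fin 4 → Fin 4 → Fin 4 → ℝ)
    (U : E4 → Fin 4 → Fin 4 → ℝ) (y : E4) (k i j : Fin 4) : ℂ :=
  nabla g (selfDual g η U) y k i j
    - interior (g y)⁻¹ (codiff g η (selfDual g η U) y) (selfDual g η U y) k * selfDual g η U y i j
    - ∑ l, (∑ a, (g y)⁻¹ l a • codiff g η (selfDual g η U) y a) * selfDualMetric g η y l k i j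

/-- `Φ[U] = i(δU)U - i(δ*U)*U`. -/
def phiForm (g : E4 → Matrix (Fin 4) (Fin 4) ℝ) (η : E4 → Fin 4 → Fin 4 → Fin 4 → Fin 4 → ℝ)
    (U : E4 → Fin 4 → Fin 4 → ℝ) (y : E4) (k : Fin 4) : ℝ :=
  interior (g y)⁻¹ (codiff g η U y) (U y) k
    - interior (g y)⁻¹ (codiff g η (star g η U) y) (star g η U y) k

/-- `Ψ[U] = - i(δU)*U - i(δ*U)U`. -/
def psiForm (g : E4 → Matrix (Fin 4) (Fin 4) ℝ) (η : E4 → Fin 4 → Fin 4 → Fin 4 → Fin 4 → ℝ)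
    (U : E4 → Fin 4 → Fin 4 → ℝ) (y : E4) (k : Fin 4) : ℝ :=
  - interior (g y)⁻¹ (codiff g η U y) (star g η U y) k
    - interior (g y)⁻¹ (codiff g η (star g η U) y) (U y) k

/-- The difference of the two sides of the conformal Killing-Yano equation
`∇_{(i} A_{j)k} = g_{ij} a_k - a_{(i} g_{j)k}` with `3 a = - δA`. Round brackets denote
symmetrization with the factor `1/2`. -/
def ckyDefect (g : E4 → Matrix (Fin 4) (Fin 4) ℝ) (η : E4 → Fin 4 → Fin 4 → Fin 4 → Fin 4 → ℝ)
    (A : E4 → Fin 4 → Fin 4 → ℝ) (y : E4) (i j k : Fin 4) : ℝ :=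
  let a : Fin 4 → ℝ := fun m => -(1 / 3) * codiff g η A y m
  (1 / 2) * (nabla g A y i j k + nabla g A y j i k)
    - (g y i j * a k - (1 / 2) * (a i * g y j k + a j * g y i k))

end Coord

/-! ### Spacetimes -/

section Manifold

variable (M : Type*) [TopologicalSpace M] [ChartedSpace E4 M]

/-- A field of 2-forms (not necessarily smooth) on `M`. -/
abbrev TwoFormField : Type _ := (x : M) → (TangentSpace (𝓡 4) x) [⋀^Fin 2]→ₗ[ℝ] ℝ

variable {M}

/-- The coordinate vector `∂_i` of the chart `e`, at the point with coordinates `y`. -/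
def coordVector (e : OpenPartialHomeomorph M E4) (y : E4) (i : Fin 4) :
    TangentSpace (𝓡 4) (e.symm y) :=
  mfderiv (𝓡 4) (𝓡 4) e.symm y (EuclideanSpace.single i (1 : ℝ) : E4)

/-- The components `U_{ij} = U(∂_i, ∂_j)` of a 2-form in the chart `e`. -/
def TwoFormField.comp (U : TwoFormField M) (e : OpenPartialHomeomorph M E4) (y : E4)
    (i j : Fin 4) : ℝ :=
  U (e.symm y) ![coordVector e y i, coordVector e y j]

/-- A 2-form is smooth if its components in every chart are smooth. -/
def TwoFormField.Smooth (U : TwoFormField M) : Prop :=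
  ∀ e ∈ IsManifold.maximalAtlas (𝓡 4) ∞ M, ∀ i j : Fin 4,
    ContDiffOn ℝ ∞ (fun y => U.comp e y i j) e.target

variable (M)

/-- An oriented spacetime: a smooth Lorentzian metric of signature `(-+++)` on the 4-manifold `M`,
together with the metric volume element `vol` that fixes the orientation. -/
structure OrientedSpacetime where
  /-- the metric -/
  metric : (x : M) → LinearMap.BilinForm ℝ (TangentSpace (𝓡 4) x)
  metric_symm : ∀ x u v, metric x u v = metric x v u
  metric_lorentzian : ∀ x, ∃ b : Module.Basis (Fin 4) ℝ (TangentSpace (𝓡 4) x),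
    ∀ i j, metric x (b i) (b j) = if i = j then (if i = 0 then -1 else 1) else 0
  metric_smooth : ∀ e ∈ IsManifold.maximalAtlas (𝓡 4) ∞ M, ∀ i j : Fin 4,
    ContDiffOn ℝ ∞
      (fun y => metric (e.symm y) (coordVector e y i) (coordVector e y j)) e.target
  /-- the metric volume element -/
  vol : (x : M) → (TangentSpace (𝓡 4) x) [⋀^Fin 4]→ₗ[ℝ] ℝ
  vol_sq : ∀ x (v : Fin 4 → TangentSpace (𝓡 4) x),
    (vol x v) ^ 2 = -(Matrix.of fun i j => metric x (v i) (v j)).det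
  vol_smooth : ∀ e ∈ IsManifold.maximalAtlas (𝓡 4) ∞ M,
    ContDiffOn ℝ ∞ (fun y => vol (e.symm y) (coordVector e y)) e.target

variable {M}

namespace OrientedSpacetime

variable (S : OrientedSpacetime M)

/-- The matrix of the metric in the chart `e`. -/
def metricComp (e : OpenPartialHomeomorph M E4) (y : E4) : Matrix (Fin 4) (Fin 4) ℝ :=
  Matrix.of fun i j => S.metric (e.symm y) (coordVector e y i) (coordVector e y j)

/-- The components `η_{ijkl}` of the metric volume element in the chart `e`. -/
def volComp (e : OpenPartialHomeomorph M E4) (y : E4) (i j k l : Fin 4) : ℝ :=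
  S.vol (e.symm y) ![coordVector e y i, coordVector e y j, coordVector e y k, coordVector e y l]

/-- `U` is a unitary 2-form: at each point it is the volume element of a time-like plane, namely of
the plane spanned by an orthonormal pair `(t, s)` with `t` time-like and `s` space-like. (The
opposite choice of sign of the volume element is obtained by replacing `s` with `-s`.) -/
def IsUnitary (U : TwoFormField M) : Prop :=
  ∀ x, ∃ t s : TangentSpace (𝓡 4) x,
    S.metric x t t = -1 ∧ S.metric x s s = 1 ∧ S.metric x t s = 0 ∧
    ∀ u v : TangentSpace (𝓡 4) x,
      U x ![u, v] = S.metric x t u * S.metric x s v - S.metric x t v * S.metric x s u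

/-- `(U, φ, ψ)` are canonical elements of the skew-symmetric tensor `A`: `U` is a smooth unitary
2-form, `φ` and `ψ` are smooth functions, and `A = e^φ (cos ψ U + sin ψ *U)`. -/
structure IsCanonicalElements (A U : TwoFormField M) (φ ψ : M → ℝ) : Prop where
  smooth_form : U.Smooth
  unitary : S.IsUnitary U
  smooth_phi : ContMDiff (𝓡 4) 𝓘(ℝ, ℝ) ∞ φ
  smooth_psi : ContMDiff (𝓡 4) 𝓘(ℝ, ℝ) ∞ ψ
  expression : ∀ e ∈ IsManifold.maximalAtlas (𝓡 4) ∞ M, ∀ y ∈ e.target, ∀ i j : Fin 4,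
    A.comp e y i j = Real.exp (φ (e.symm y)) *
      (Real.cos (ψ (e.symm y)) * U.comp e y i j
        + Real.sin (ψ (e.symm y)) *
          Coord.star (S.metricComp e) (S.volComp e) (U.comp e) y i j)

/-- `A` satisfies the conformal Killing-Yano equation. -/
def IsConformalKillingYano (A : TwoFormField M) : Prop :=
  ∀ e ∈ IsManifold.maximalAtlas (𝓡 4) ∞ M, ∀ y ∈ e.target, ∀ i j k : Fin 4,
    Coord.ckyDefect (S.metricComp e) (S.volComp e) (A.comp e) y i j k = 0

/-- The umbilical condition `Σ[U] = 0`. -/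
def SigmaEqZero (U : TwoFormField M) : Prop :=
  ∀ e ∈ IsManifold.maximalAtlas (𝓡 4) ∞ M, ∀ y ∈ e.target, ∀ k i j : Fin 4,
    Coord.sigma (S.metricComp e) (S.volComp e) (U.comp e) y k i j = 0

/-- The equation `-2 dφ = Φ[U]`. -/
def PhiEquation (U : TwoFormField M) (φ : M → ℝ) : Prop :=
  ∀ e ∈ IsManifold.maximalAtlas (𝓡 4) ∞ M, ∀ y ∈ e.target, ∀ k : Fin 4,
    -2 * Coord.pd k (fun z => φ (e.symm z)) y =
      Coord.phiForm (S.metricComp e) (S.volComp e) (U.comp e) y k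

/-- The equation `-2 dψ = Ψ[U]`. -/
def PsiEquation (U : TwoFormField M) (ψ : M → ℝ) : Prop :=
  ∀ e ∈ IsManifold.maximalAtlas (𝓡 4) ∞ M, ∀ y ∈ e.target, ∀ k : Fin 4,
    -2 * Coord.pd k (fun z => ψ (e.symm z)) y =
      Coord.psiForm (S.metricComp e) (S.volComp e) (U.comp e) y k

end OrientedSpacetime

end Manifold

end

open scoped Manifold ContDiff

noncomputable section

/-! The equivalence is pointwise, so it is proved at one point of an arbitrary chart. Write `u` for
$U$, `w` for ${*U}$, `N` for $\nabla U$, and let `cform` be the family of tensors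
$b^lG_{lkij}+\kappa^l\eta_{lkij}$ with $G_{lkij}=g_{li}g_{kj}-g_{lj}g_{ki}$.

Two facts about this family drive the proof. A tensor $T_{kij}$ skew in $i,j$ solves the conformal
Killing-Yano equation exactly when it belongs to the family (`defect_cform`,
`exists_eq_cform_of_defect`). The family is also stable under the Hodge dual, which sends
$(b,\kappa)$ to $(-\kappa,b)$ (`dual_cform`). Since $*$ is parallel (`nablaM_dual`) and $**=-1$, the
derivative is $\nabla A=e^\phi(\cos\psi+\sin\psi\,*)X$ with $X=N+d\phi\otimes u+d\psi\otimes w$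
(`nablaM_canonical`). Scaling and duality rotation are invertible on the family, so the equation for
$A$ says that $X$ is a `cform` (`defect_rotation_iff`).

It remains to solve $X=\mathrm{cform}(b,\kappa)$ (`UnitaryJet.eq_cform_iff`). Because $(u,u)=-2$ and
$(u,w)=0$ are constant, contracting with $u$ and $w$ removes $N$ and gives
$d\phi=-(i(b)u+i(\kappa)w)$ and $d\psi=i(b)w-i(\kappa)u$. The divergences of $X$ and ${*X}$,
together with $uhu-whw=g$ and $uhw=whu=0$ ($h$ the inverse metric), give $\delta U=2b$ and
$\delta{*U}=-2\kappa$. Substitution turns the first relations into the equations for $d\phi$ and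
$d\psi$, and $X=\mathrm{cform}(b,\kappa)$ into the real part of $\Sigma[U]=0$. The imaginary part is
the dual of the real part up to a factor (`sigma_eq_zero_iff`). The converse is substitution with
$b=\frac12(\delta U)^\sharp$ and $\kappa=-\frac12(\delta{*U})^\sharp$. -/

namespace Coord

/-! ### Contractions of the product of two volume elements. -/

/-- The explicit value of a determinant of size four. -/
theorem det_fin_four (A : Matrix (Fin 4) (Fin 4) ℝ) :
    A.det = A 0 0 * (A 1 1 * (A 2 2 * A 3 3 - A 2 3 * A 3 2)
        - A 1 2 * (A 2 1 * A 3 3 - A 2 3 * A 3 1) + A 1 3 * (A 2 1 * A 3 2 - A 2 2 * A 3 1))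
      - A 0 1 * (A 1 0 * (A 2 2 * A 3 3 - A 2 3 * A 3 2)
        - A 1 2 * (A 2 0 * A 3 3 - A 2 3 * A 3 0) + A 1 3 * (A 2 0 * A 3 2 - A 2 2 * A 3 0))
      + A 0 2 * (A 1 0 * (A 2 1 * A 3 3 - A 2 3 * A 3 1)
        - A 1 1 * (A 2 0 * A 3 3 - A 2 3 * A 3 0) + A 1 3 * (A 2 0 * A 3 1 - A 2 1 * A 3 0))
      - A 0 3 * (A 1 0 * (A 2 1 * A 3 2 - A 2 2 * A 3 1)
        - A 1 1 * (A 2 0 * A 3 2 - A 2 2 * A 3 0) + A 1 2 * (A 2 0 * A 3 1 - A 2 1 * A 3 0)) := by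
  have e00 : Fin.succAbove (0 : Fin 4) (0 : Fin 3) = 1 := rfl
  have e01 : Fin.succAbove (0 : Fin 4) (1 : Fin 3) = 2 := rfl
  have e02 : Fin.succAbove (0 : Fin 4) (2 : Fin 3) = 3 := rfl
  have e10 : Fin.succAbove (1 : Fin 4) (0 : Fin 3) = 0 := rfl
  have e11 : Fin.succAbove (1 : Fin 4) (1 : Fin 3) = 2 := rfl
  have e12 : Fin.succAbove (1 : Fin 4) (2 : Fin 3) = 3 := rfl
  have e20 : Fin.succAbove (2 : Fin 4) (0 : Fin 3) = 0 := rfl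
  have e21 : Fin.succAbove (2 : Fin 4) (1 : Fin 3) = 1 := rfl
  have e22 : Fin.succAbove (2 : Fin 4) (2 : Fin 3) = 3 := rfl
  have e30 : Fin.succAbove (3 : Fin 4) (0 : Fin 3) = 0 := rfl
  have e31 : Fin.succAbove (3 : Fin 4) (1 : Fin 3) = 1 := rfl
  have e32 : Fin.succAbove (3 : Fin 4) (2 : Fin 3) = 2 := rfl
  have s0 : Fin.succ (0 : Fin 3) = 1 := rfl
  have s1 : Fin.succ (1 : Fin 3) = 2 := rfl
  have s2 : Fin.succ (2 : Fin 3) = 3 := rfl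
  have v0 : ((0 : Fin 4) : ℕ) = 0 := rfl
  have v1 : ((1 : Fin 4) : ℕ) = 1 := rfl
  have v2 : ((2 : Fin 4) : ℕ) = 2 := rfl
  have v3 : ((3 : Fin 4) : ℕ) = 3 := rfl
  simp only [Matrix.det_succ_row_zero (n := 3), Fin.sum_univ_four, Matrix.det_fin_three,
    Matrix.submatrix_apply, e00, e01, e02, e10, e11, e12, e20, e21, e22, e30, e31, e32, s0, s1, s2,
    v0, v1, v2, v3]
  ring

/-- The components at one point of a metric `g`, its inverse `h` and a metric volume element `η`
of Lorentzian sign. -/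
structure IsMetricVolume (g h : Matrix (Fin 4) (Fin 4) ℝ)
    (η : Fin 4 → Fin 4 → Fin 4 → Fin 4 → ℝ) : Prop where
  metric_symm : ∀ i j, g i j = g j i
  inv_symm : ∀ i j, h i j = h j i
  inv_mul : ∀ i j, ∑ k, h i k * g k j = if i = j then 1 else 0
  mul_vol : ∀ a b c d i j k l,
    η a b c d * η i j k l = -(g.submatrix ![a, b, c, d] ![i, j, k, l]).det
  swap₀ : ∀ i j k l, η j i k l = -η i j k l
  swap₁ : ∀ i j k l, η i k j l = -η i j k l
  swap₂ : ∀ i j k l, η i j l k = -η i j k l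

namespace IsMetricVolume

variable {g h : Matrix (Fin 4) (Fin 4) ℝ} {η : Fin 4 → Fin 4 → Fin 4 → Fin 4 → ℝ}

theorem sum_inv_mul_left (H : IsMetricVolume g h η) (y : Fin 4) (X : Fin 4 → ℝ) :
    ∑ k, ∑ a, h k a * (g k y * X a) = X y := by
  rw [Finset.sum_comm]
  have : ∀ a, ∑ k, h k a * (g k y * X a) = (if a = y then 1 else 0) * X a := by
    intro a
    rw [← H.inv_mul, Finset.sum_mul]
    exact Finset.sum_congr rfl fun k _ => by rw [H.inv_symm k a]; ring
  simp [this]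

theorem sum_inv_mul_metric (H : IsMetricVolume g h η) : ∑ k, ∑ a, h k a * g k a = 4 := by
  have : ∀ k, ∑ a, h k a * g k a = 1 := by
    intro k
    have := H.inv_mul k k
    rw [if_pos rfl] at this
    rw [← this]
    exact Finset.sum_congr rfl fun a _ => by rw [H.metric_symm k a]
  simp [this]

/-- The determinant of the Gram matrix of two triples of coordinate vectors. -/
def gram₃ (g : Matrix (Fin 4) (Fin 4) ℝ) (i j l b c d : Fin 4) : ℝ :=
  g i b * (g j c * g l d - g j d * g l c) - g i c * (g j b * g l d - g j d * g l b)
    + g i d * (g j b * g l c - g j c * g l b)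

/-- The Gram determinant is expanded so that `k` and `a` each appear in a single factor of every
term; contraction with `h k a` then works term by term. -/
theorem vol_mul_vol_eq (H : IsMetricVolume g h η) (k i j l a b c d : Fin 4) :
    η k i j l * η a b c d = -(g k a * gram₃ g i j l b c d
      - g k b * (g i a * (g j c * g l d - g j d * g l c) - g j a * (g i c * g l d - g i d * g l c)
        + g l a * (g i c * g j d - g i d * g j c))
      + g k c * (g i a * (g j b * g l d - g j d * g l b) - g j a * (g i b * g l d - g i d * g l b)
        + g l a * (g i b * g j d - g i d * g j b))
      - g k d * (g i a * (g j b * g l c - g j c * g l b) - g j a * (g i b * g l c - g i c * g l b)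
        + g l a * (g i b * g j c - g i c * g j b))) := by
  rw [H.mul_vol, det_fin_four]
  simp only [Matrix.submatrix_apply, gram₃, Matrix.cons_val]
  ring

/-- The trace term counts 4 and each of the three other terms counts −1, leaving one copy of the
Gram determinant. The minus sign is the Lorentzian one. -/
theorem contract_vol_vol (H : IsMetricVolume g h η) (i j l b c d : Fin 4) :
    ∑ k, ∑ a, h k a * (η k i j l * η a b c d) = -gram₃ g i j l b c d := by
  have key : ∀ k a, h k a * (η k i j l * η a b c d) =
      -(h k a * g k a) * gram₃ g i j l b c d
      + h k a * (g k b * (g i a * (g j c * g l d - g j d * g l c)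
        - g j a * (g i c * g l d - g i d * g l c) + g l a * (g i c * g j d - g i d * g j c)))
      - h k a * (g k c * (g i a * (g j b * g l d - g j d * g l b)
        - g j a * (g i b * g l d - g i d * g l b) + g l a * (g i b * g j d - g i d * g j b)))
      + h k a * (g k d * (g i a * (g j b * g l c - g j c * g l b)
        - g j a * (g i b * g l c - g i c * g l b) + g l a * (g i b * g j c - g i c * g j b))) := by
    intro k a
    rw [H.vol_mul_vol_eq]; ring
  simp_rw [key, Finset.sum_add_distrib, Finset.sum_sub_distrib, Finset.sum_add_distrib,
    ← Finset.sum_mul, Finset.sum_neg_distrib, H.sum_inv_mul_metric]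
  rw [H.sum_inv_mul_left b, H.sum_inv_mul_left c, H.sum_inv_mul_left d]
  unfold gram₃; ring

theorem contract_gram₃ (H : IsMetricVolume g h η) (i j b c : Fin 4) :
    ∑ k, ∑ a, h k a * gram₃ g k i j a b c = 2 * (g i b * g j c - g i c * g j b) := by
  have key : ∀ k a, h k a * gram₃ g k i j a b c =
      (h k a * g k a) * (g i b * g j c - g i c * g j b)
      - h k a * (g k b * (g i a * g j c - g i c * g j a))
      + h k a * (g k c * (g i a * g j b - g i b * g j a)) := by
    intro k a; unfold gram₃; ring
  simp_rw [key, Finset.sum_add_distrib, Finset.sum_sub_distrib, ← Finset.sum_mul,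
    H.sum_inv_mul_metric]
  rw [H.sum_inv_mul_left b, H.sum_inv_mul_left c]
  ring

/-- A cycle of length four is odd, and its square exchanges the two pairs of indices with an even
sign. -/
theorem vol_cycle (H : IsMetricVolume g h η) (i j k l : Fin 4) : η i j k l = -η j k l i := by
  rw [H.swap₂ j k i l, H.swap₁ j i k l, H.swap₀ i j k l]; ring

theorem vol_pairs (H : IsMetricVolume g h η) (i j k l : Fin 4) : η i j k l = η k l i j := by
  rw [H.vol_cycle i, H.vol_cycle j, neg_neg]

theorem contract_vol_vol₂ (H : IsMetricVolume g h η) (i j c d : Fin 4) :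
    ∑ l, ∑ b, h l b * ∑ k, ∑ a, h k a * (η i j k l * η a b c d)
      = -(2 * (g i c * g j d - g i d * g j c)) := by
  have : ∀ l b, ∑ k, ∑ a, h k a * (η i j k l * η a b c d) = -gram₃ g l i j b c d := by
    intro l b
    rw [← H.contract_vol_vol]
    refine Finset.sum_congr rfl fun k _ => Finset.sum_congr rfl fun a _ => ?_
    rw [H.vol_pairs i j k l]
  simp_rw [this, mul_neg, Finset.sum_neg_distrib, H.contract_gram₃]

end IsMetricVolume
end Coord

/-! ### Hodge duality, contractions and the `cform` family at one point. -/

namespace Coord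

/-- Abbreviation for the arrays of components of the twice covariant tensors at a point. -/
abbrev Mat4 : Type := Matrix (Fin 4) (Fin 4) ℝ

theorem sum_pair_comm (F : Fin 4 → Fin 4 → Fin 4 → Fin 4 → ℝ) :
    ∑ i, ∑ j, ∑ m, ∑ n, F i j m n = ∑ m, ∑ n, ∑ i, ∑ j, F i j m n := by
  have e : ∀ i, ∑ j, ∑ m, ∑ n, F i j m n = ∑ m, ∑ n, ∑ j, F i j m n := by
    intro i
    rw [Finset.sum_comm]
    exact Finset.sum_congr rfl fun m _ => Finset.sum_comm
  simp_rw [e]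
  rw [Finset.sum_comm]
  exact Finset.sum_congr rfl fun m _ => Finset.sum_comm

/-- The contravariant components of a twice covariant tensor. -/
def raise (h A : Mat4) : Mat4 := Matrix.of fun k l => ∑ m, ∑ n, h k m * h l n * A m n

/-- The Hodge dual of the 2-forms at one point. -/
def dual (h : Mat4) (η : Fin 4 → Fin 4 → Fin 4 → Fin 4 → ℝ) : Mat4 →ₗ[ℝ] Mat4 where
  toFun A := Matrix.of fun i j => (1 / 2 : ℝ) * ∑ k, ∑ l, η i j k l * raise h A k l
  map_add' A B := by
    ext i j
    simp [raise, mul_add, Finset.sum_add_distrib]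
  map_smul' c A := by
    ext i j
    simp only [raise, Matrix.of_apply, Matrix.smul_apply, smul_eq_mul, RingHom.id_apply,
      Finset.mul_sum]
    refine Finset.sum_congr rfl fun _ _ => Finset.sum_congr rfl fun _ _ =>
      Finset.sum_congr rfl fun _ _ => Finset.sum_congr rfl fun _ _ => by ring

theorem dual_apply (h : Mat4) (η : Fin 4 → Fin 4 → Fin 4 → Fin 4 → ℝ) (A : Mat4) (i j : Fin 4) :
    dual h η A i j = (1 / 2 : ℝ) * ∑ k, ∑ l, η i j k l * raise h A k l := rfl

/-- The contraction `A^{ij} B_{ij}` with a fixed tensor `A`. -/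
def contr (h A : Mat4) : Mat4 →ₗ[ℝ] ℝ where
  toFun B := ∑ i, ∑ j, raise h A i j * B i j
  map_add' B C := by simp [mul_add, Finset.sum_add_distrib]
  map_smul' c B := by
    simp only [Matrix.smul_apply, smul_eq_mul, RingHom.id_apply, Finset.mul_sum]
    exact Finset.sum_congr rfl fun _ _ => Finset.sum_congr rfl fun _ _ => by ring

theorem contr_apply (h A B : Mat4) : contr h A B = ∑ i, ∑ j, raise h A i j * B i j := rfl

/-- The 2-form `(i, j) ↦ g_{li} g_{kj} - g_{lj} g_{ki}`. -/
def biform (g : Mat4) (l k : Fin 4) : Mat4 :=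
  Matrix.of fun i j => g l i * g k j - g l j * g k i

/-- The 2-form `(i, j) ↦ η_{lkij}`. -/
def volform (η : Fin 4 → Fin 4 → Fin 4 → Fin 4 → ℝ) (l k : Fin 4) : Mat4 :=
  Matrix.of fun i j => η l k i j

/-- The tensor `b^l G_{lkij} + κ^l η_{lkij}`, the general form of the covariant derivative of a
conformal Killing-Yano tensor. -/
def cform (g : Mat4) (η : Fin 4 → Fin 4 → Fin 4 → Fin 4 → ℝ) (b κ : Fin 4 → ℝ) (k : Fin 4) : Mat4 :=
  ∑ l, b l • biform g l k + ∑ l, κ l • volform η l k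

/-- The divergence `∇^k A_{kj}` computed from the components `T_{kij} = ∇_k A_{ij}`. -/
def divergence (h : Mat4) (T : Fin 4 → Mat4) (j : Fin 4) : ℝ := ∑ k, ∑ a, h k a * T k a j

/-- The conformal Killing-Yano defect computed from the components `T_{kij} = ∇_k A_{ij}`. -/
def defect (g h : Mat4) (T : Fin 4 → Mat4) (i j k : Fin 4) : ℝ :=
  (1 / 2) * (T i j k + T j i k)
    - (g i j * (1 / 3 * divergence h T k)
      - (1 / 2) * (1 / 3 * divergence h T i * g j k + 1 / 3 * divergence h T j * g i k))

namespace IsMetricVolume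

variable {g h : Mat4} {η : Fin 4 → Fin 4 → Fin 4 → Fin 4 → ℝ}

theorem sum_metric_inv (H : IsMetricVolume g h η) (i : Fin 4) (X : Fin 4 → ℝ) :
    ∑ a, g i a * ∑ m, h a m * X m = X i := by
  rw [← H.sum_inv_mul_left i X]
  refine Finset.sum_congr rfl fun a _ => ?_
  rw [Finset.mul_sum]
  exact Finset.sum_congr rfl fun m _ => by rw [H.metric_symm i a]; ring

theorem sum_inv_metric (H : IsMetricVolume g h η) (i : Fin 4) (X : Fin 4 → ℝ) :
    ∑ a, h i a * ∑ m, g a m * X m = X i := by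
  simp_rw [Finset.mul_sum]
  rw [Finset.sum_comm]
  have : ∀ m, ∑ a, h i a * (g a m * X m) = (if i = m then 1 else 0) * X m := by
    intro m
    rw [← H.inv_mul, Finset.sum_mul]
    exact Finset.sum_congr rfl fun k _ => by ring
  simp [this]

theorem raise_eq (A : Mat4) (k l : Fin 4) :
    raise h A k l = ∑ m, h k m * ∑ n, h l n * A m n := by
  simp only [raise, Matrix.of_apply, Finset.mul_sum, mul_assoc]

theorem lower_raise (H : IsMetricVolume g h η) (A : Mat4) (i j : Fin 4) :
    ∑ a, ∑ b, raise h A a b * (g a i * g b j) = A i j := by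
  have : ∀ a, ∑ b, raise h A a b * (g a i * g b j) = g i a * ∑ m, h a m * A m j := by
    intro a
    have h2 : ∀ b, raise h A a b * (g a i * g b j)
        = g i a * ∑ m, h a m * (g j b * ∑ n, h b n * A m n) := by
      intro b
      rw [raise_eq, H.metric_symm a i, H.metric_symm b j, Finset.sum_mul, Finset.mul_sum]
      exact Finset.sum_congr rfl fun m _ => by ring
    simp_rw [h2, ← Finset.mul_sum]
    rw [Finset.sum_comm]
    simp_rw [← Finset.mul_sum, H.sum_metric_inv]
  simp_rw [this, H.sum_metric_inv]

/-- The simple forms `biform g a b` span the 2-forms, so linear identities such as `dual_dual` need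
checking only on them. -/
theorem eq_sum_biform (H : IsMetricVolume g h η) {A : Mat4} (hA : ∀ i j, A j i = -A i j) :
    A = (1 / 2 : ℝ) • ∑ a, ∑ b, raise h A a b • biform g a b := by
  ext i j
  simp only [Matrix.smul_apply, Matrix.sum_apply, biform, Matrix.of_apply, smul_eq_mul, mul_sub,
    Finset.sum_sub_distrib, H.lower_raise]
  rw [hA i j]; ring

theorem raise_biform (H : IsMetricVolume g h η) (a b k l : Fin 4) :
    raise h (biform g a b) k l = (if k = a then 1 else 0) * (if l = b then 1 else 0)
      - (if l = a then 1 else 0) * (if k = b then 1 else 0) := by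
  simp only [← H.inv_mul, raise, biform, Matrix.of_apply, mul_sub, Finset.sum_sub_distrib,
    Finset.sum_mul_sum]
  congr 1
  · exact Finset.sum_congr rfl fun m _ => Finset.sum_congr rfl fun n _ => by
      rw [H.metric_symm a m, H.metric_symm b n]; ring
  · rw [Finset.sum_comm]
    exact Finset.sum_congr rfl fun m _ => Finset.sum_congr rfl fun n _ => by
      rw [H.metric_symm a m, H.metric_symm b n]; ring

theorem dual_biform (H : IsMetricVolume g h η) (a b : Fin 4) :
    dual h η (biform g a b) = volform η a b := by
  ext i j
  simp only [dual_apply, H.raise_biform, mul_sub, Finset.sum_sub_distrib]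
  simp [volform]
  rw [H.swap₂ i j a b, H.vol_pairs i j a b]; ring

/-- Double contraction of two volume elements; its Lorentzian sign is the origin of $**=-1$ on
2-forms. -/
theorem dual_volform (H : IsMetricVolume g h η) (a b : Fin 4) :
    dual h η (volform η a b) = -biform g a b := by
  ext i j
  have := H.contract_vol_vol₂ i j a b
  have e : ∑ k, ∑ l, η i j k l * raise h (volform η a b) k l
      = ∑ l, ∑ n, h l n * ∑ k, ∑ m, h k m * (η i j k l * η m n a b) := by
    simp only [raise, volform, Matrix.of_apply, Finset.mul_sum]
    rw [Finset.sum_comm]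
    refine Finset.sum_congr rfl fun l _ => ?_
    conv_rhs => rw [Finset.sum_comm]
    refine Finset.sum_congr rfl fun k _ => ?_
    conv_rhs => rw [Finset.sum_comm]
    exact Finset.sum_congr rfl fun m _ => Finset.sum_congr rfl fun n _ => by
      rw [H.vol_pairs a b]; ring
  rw [dual_apply, e, this]
  simp only [biform, Matrix.neg_apply, Matrix.of_apply]
  rw [H.metric_symm a i, H.metric_symm b j, H.metric_symm a j, H.metric_symm b i]; ring

theorem dual_dual (H : IsMetricVolume g h η) {A : Mat4} (hA : ∀ i j, A j i = -A i j) :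
    dual h η (dual h η A) = -A := by
  conv_lhs => rw [H.eq_sum_biform hA]
  conv_rhs => rw [H.eq_sum_biform hA]
  simp only [map_smul, map_sum, H.dual_biform, H.dual_volform, smul_neg, Finset.sum_neg_distrib]

theorem dual_antisymm (H : IsMetricVolume g h η) (A : Mat4) (i j : Fin 4) :
    dual h η A j i = -dual h η A i j := by
  simp only [dual_apply, H.swap₀ i j, neg_mul, Finset.sum_neg_distrib, mul_neg]

/-- Duality exchanges `biform` and `volform` up to sign, hence acts on the parameters as a quarter
turn. This makes the conformal Killing-Yano equation invariant under duality rotations. -/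
theorem dual_cform (H : IsMetricVolume g h η) (b κ : Fin 4 → ℝ) (k : Fin 4) :
    dual h η (cform g η b κ k) = cform g η (-κ) b k := by
  simp only [cform, map_add, map_sum, map_smul, H.dual_biform, H.dual_volform, Pi.neg_apply,
    smul_neg, neg_smul]
  abel

/-- The Hodge dual is self-adjoint because $\eta_{ijkl}=\eta_{klij}$. -/
theorem contr_dual (H : IsMetricVolume g h η) (A B : Mat4) :
    contr h A (dual h η B) = contr h (dual h η A) B := by
  have e : contr h (dual h η A) B = ∑ i, ∑ j, dual h η A i j * raise h B i j := by
    simp only [contr_apply, raise, Matrix.of_apply, Finset.sum_mul, Finset.mul_sum]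
    rw [sum_pair_comm]
    refine Finset.sum_congr rfl fun m _ => Finset.sum_congr rfl fun n _ =>
      Finset.sum_congr rfl fun i _ => Finset.sum_congr rfl fun j _ => ?_
    rw [H.inv_symm i m, H.inv_symm j n]; ring
  rw [e]
  simp only [contr_apply, dual_apply, Finset.mul_sum, Finset.sum_mul]
  rw [sum_pair_comm]
  refine Finset.sum_congr rfl fun m _ => Finset.sum_congr rfl fun n _ =>
      Finset.sum_congr rfl fun i _ => Finset.sum_congr rfl fun j _ => ?_
  rw [H.vol_pairs i j m n]; ring

/-- Used with `u` the unitary form or its dual, to read off $d\phi$ and $d\psi$ from the parameters.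
-/
theorem contr_cform (H : IsMetricVolume g h η) {u : Mat4} (hu : ∀ i j, u j i = -u i j)
    (b κ : Fin 4 → ℝ) (k : Fin 4) :
    contr h u (cform g η b κ k)
      = 2 * (∑ l, b l * u l k) + 2 * ∑ l, κ l * dual h η u l k := by
  have h1 : ∀ l, contr h u (biform g l k) = 2 * u l k := by
    intro l
    simp only [contr_apply, biform, Matrix.of_apply, mul_sub, Finset.sum_sub_distrib]
    have h3 : ∀ p q, ∑ i, ∑ j, raise h u i j * (g p i * g q j) = u p q := by
      intro p q
      rw [← H.lower_raise u p q]
      exact Finset.sum_congr rfl fun i _ => Finset.sum_congr rfl fun j _ => by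
        rw [H.metric_symm p i, H.metric_symm q j]
    have h4 : ∑ i, ∑ j, raise h u i j * (g l j * g k i) = u k l := by
      rw [← h3 k l]
      exact Finset.sum_congr rfl fun i _ => Finset.sum_congr rfl fun j _ => by ring
    rw [h3, h4, hu l k]; ring
  have h2 : ∀ l, contr h u (volform η l k) = 2 * dual h η u l k := by
    intro l
    simp only [contr_apply, dual_apply, volform, Matrix.of_apply]
    rw [← mul_assoc]
    norm_num
    exact Finset.sum_congr rfl fun i _ => Finset.sum_congr rfl fun j _ => by ring
  simp only [cform, map_add, map_sum, map_smul, h1, h2, smul_eq_mul, Finset.mul_sum]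
  congr 1 <;> exact Finset.sum_congr rfl fun l _ => by ring

theorem cform_apply (b κ : Fin 4 → ℝ) (k i j : Fin 4) :
    cform g η b κ k i j = (∑ l, b l * g l i) * g k j - (∑ l, b l * g l j) * g k i
      + ∑ l, κ l * η l k i j := by
  simp only [cform, Matrix.add_apply, Matrix.sum_apply, Matrix.smul_apply, biform, volform,
    Matrix.of_apply, smul_eq_mul, mul_sub, Finset.sum_sub_distrib, Finset.sum_mul, mul_assoc]

theorem sum_inv_vol (H : IsMetricVolume g h η) (l j : Fin 4) :
    ∑ k, ∑ a, h k a * η l k a j = 0 := by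
  have e : ∑ k, ∑ a, h k a * η l k a j = -∑ k, ∑ a, h k a * η l k a j := by
    conv_lhs => rw [Finset.sum_comm]
    rw [← Finset.sum_neg_distrib]
    refine Finset.sum_congr rfl fun k _ => ?_
    rw [← Finset.sum_neg_distrib]
    exact Finset.sum_congr rfl fun a _ => by rw [H.swap₁ l k a j, H.inv_symm]; ring
  linarith

/-- The two metric terms contribute $1-4$, and the volume term drops out as a symmetric-skew
contraction. The resulting 3 is the one in $3a=-\delta A$. -/
theorem divergence_cform (H : IsMetricVolume g h η) (b κ : Fin 4 → ℝ) (j : Fin 4) :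
    divergence h (cform g η b κ) j = -3 * ∑ l, b l * g l j := by
  have e : ∀ k a, h k a * cform g η b κ k a j =
      h k a * (g k j * ∑ l, b l * g l a) - (h k a * g k a) * (∑ l, b l * g l j)
        + ∑ l, κ l * (h k a * η l k a j) := by
    intro k a
    rw [cform_apply, mul_add, Finset.mul_sum]
    congr 1
    · ring
    · exact Finset.sum_congr rfl fun l _ => by ring
  have e2 : ∑ k, ∑ a, ∑ l, κ l * (h k a * η l k a j) = 0 := by
    have : ∀ k, ∑ a, ∑ l, κ l * (h k a * η l k a j) = ∑ l, κ l * ∑ a, h k a * η l k a j := by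
      intro k
      rw [Finset.sum_comm]
      simp_rw [Finset.mul_sum]
    simp_rw [this]
    rw [Finset.sum_comm]
    simp_rw [← Finset.mul_sum, H.sum_inv_vol]
    simp
  simp only [divergence, e, Finset.sum_add_distrib, Finset.sum_sub_distrib, ← Finset.sum_mul,
    H.sum_inv_mul_metric, e2]
  rw [H.sum_inv_mul_left j fun a => ∑ l, b l * g l a]
  ring

/-- Symmetrizing in `i, j` kills the volume part; by the divergence formula the metric part equals
the trace terms of the equation. -/
theorem defect_cform (H : IsMetricVolume g h η) (b κ : Fin 4 → ℝ) (i j k : Fin 4) :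
    defect g h (cform g η b κ) i j k = 0 := by
  have e : ∑ l, κ l * η l i j k = -∑ l, κ l * η l j i k := by
    rw [← Finset.sum_neg_distrib]
    exact Finset.sum_congr rfl fun l _ => by rw [H.swap₁ l i j k]; ring
  simp only [defect, H.divergence_cform, cform_apply, e]
  rw [H.metric_symm j i]
  ring

end IsMetricVolume
end Coord

/-! ### Solving the conformal Killing-Yano equation at one point. -/

namespace Coord
namespace IsMetricVolume

variable {g h : Mat4} {η : Fin 4 → Fin 4 → Fin 4 → Fin 4 → ℝ}

theorem lower_raise₃ (H : IsMetricVolume g h η) (Y : Fin 4 → Mat4) (k i j : Fin 4) :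
    ∑ a, ∑ b, ∑ c, (∑ m, h a m * raise h (Y m) b c) * (g a k * (g b i * g c j)) = Y k i j := by
  have e : ∀ a, ∑ b, ∑ c, (∑ m, h a m * raise h (Y m) b c) * (g a k * (g b i * g c j))
      = g k a * ∑ m, h a m * Y m i j := by
    intro a
    rw [H.metric_symm k a]
    simp_rw [← H.lower_raise (Y _) i j, Finset.mul_sum, Finset.sum_mul]
    conv_rhs => rw [Finset.sum_comm]
    refine Finset.sum_congr rfl fun b _ => ?_
    conv_rhs => rw [Finset.sum_comm]
    exact Finset.sum_congr rfl fun c _ => Finset.sum_congr rfl fun m _ => by ring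
  simp_rw [e, H.sum_metric_inv]

/-- A totally skew-symmetric tensor with three indices is the Hodge dual of a vector. -/
theorem exists_eq_sum_vol (H : IsMetricVolume g h η) (Y : Fin 4 → Mat4)
    (h₁ : ∀ k i j, Y k j i = -Y k i j) (h₂ : ∀ k i j, Y i k j = -Y k i j) :
    ∃ κ : Fin 4 → ℝ, ∀ k i j, Y k i j = ∑ l, κ l * η l k i j := by
  set R : Fin 4 → Fin 4 → Fin 4 → ℝ := fun a b c => ∑ m, h a m * raise h (Y m) b c with hR
  -- The vector is $\kappa^l=-\frac16\eta^{labc}Y_{abc}$: contracting it back with `η` yields minus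
  -- a Gram determinant, whose $3!$ terms are signed permutations of `Y`, all equal by skew
  -- symmetry.
  refine ⟨fun l => ∑ m, h l m * (-(1 / 6) * ∑ a, ∑ b, ∑ c, η m a b c * R a b c), fun k i j => ?_⟩
  have e1 : ∑ l, (∑ m, h l m * (-(1 / 6) * ∑ a, ∑ b, ∑ c, η m a b c * R a b c)) * η l k i j
      = -(1 / 6) * ∑ a, ∑ b, ∑ c, R a b c * ∑ l, ∑ m, h l m * (η l k i j * η m a b c) := by
    simp only [Finset.mul_sum, Finset.sum_mul]
    rw [sum_pair_comm]
    refine Finset.sum_congr rfl fun a _ => Finset.sum_congr rfl fun b _ => ?_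
    conv_rhs => rw [Finset.sum_comm]
    refine Finset.sum_congr rfl fun l _ => ?_
    conv_rhs => rw [Finset.sum_comm]
    exact Finset.sum_congr rfl fun m _ => Finset.sum_congr rfl fun c _ => by ring
  have L := H.lower_raise₃ Y
  have e2 : ∀ a b c, R a b c * ∑ l, ∑ m, h l m * (η l k i j * η m a b c)
      = -(R a b c * (g a k * (g b i * g c j))) + R a b c * (g a k * (g b j * g c i))
        + R a b c * (g a i * (g b k * g c j)) - R a b c * (g a j * (g b k * g c i))
        - R a b c * (g a i * (g b j * g c k)) + R a b c * (g a j * (g b i * g c k)) := by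
    intro a b c
    rw [H.contract_vol_vol, gram₃, H.metric_symm k a, H.metric_symm k b, H.metric_symm k c,
      H.metric_symm i a, H.metric_symm i b, H.metric_symm i c, H.metric_symm j a,
      H.metric_symm j b, H.metric_symm j c]
    ring
  simp_rw [e1, e2, Finset.sum_add_distrib, Finset.sum_sub_distrib, Finset.sum_add_distrib,
    Finset.sum_neg_distrib]
  simp only [hR, L]
  have a1 := h₁ k i j
  have a2 := h₂ k i j
  have a3 := h₂ k j i
  have a4 := h₁ i k j
  have a5 := h₁ j k i
  linarith

/-- Once the trace part built from the divergence is removed from `T`, vanishing of the defect says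
exactly that the remainder is skew in its first two indices. Being skew in the last two as well, it
is totally skew and so the dual of a vector. -/
theorem exists_eq_cform_of_defect (H : IsMetricVolume g h η) (T : Fin 4 → Mat4)
    (hT : ∀ k i j, T k j i = -T k i j) (hd : ∀ i j k, defect g h T i j k = 0) :
    ∃ b κ : Fin 4 → ℝ, T = cform g η b κ := by
  set a : Fin 4 → ℝ := fun m => 1 / 3 * divergence h T m with ha
  obtain ⟨κ, hκ⟩ := H.exists_eq_sum_vol
    (fun k => Matrix.of fun i j => T k i j + (a i * g k j - a j * g k i))
    (fun k i j => by simp only [Matrix.of_apply]; rw [hT k i j]; ring)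
    (fun k i j => by
      have := hd i k j
      simp only [defect] at this
      simp only [Matrix.of_apply, ha]
      rw [H.metric_symm k i]
      linarith)
  -- The sign comes from the divergence $-3b$ of a `cform`, against the normalization
  -- $a=\frac13\operatorname{div}T$.
  refine ⟨fun l => -∑ m, h l m * a m, κ, ?_⟩
  funext k
  ext i j
  have low : ∀ i, ∑ l, (-∑ m, h l m * a m) * g l i = -a i := by
    intro i
    rw [← H.sum_metric_inv i a, ← Finset.sum_neg_distrib]
    exact Finset.sum_congr rfl fun l _ => by rw [H.metric_symm i l]; ring
  have := hκ k i j
  simp only [Matrix.of_apply] at this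
  rw [cform_apply, low, low, ← this]
  ring

theorem mulVec_inv_metric (H : IsMetricVolume g h η) (v : Fin 4 → ℝ) :
    Matrix.mulVec h (Matrix.vecMul v g) = v := by
  funext i
  simp only [Matrix.vecMul, Matrix.mulVec, dotProduct]
  rw [← H.sum_inv_metric i v]
  exact Finset.sum_congr rfl fun l _ => by
    congr 1
    exact Finset.sum_congr rfl fun m _ => by rw [H.metric_symm l m]; ring

end IsMetricVolume

/-- The interior product of a covector with a 2-form. -/
theorem interior_eq_vecMul (h : Mat4) (v : Fin 4 → ℝ) (A : Mat4) :
    interior h v A = Matrix.vecMul (Matrix.mulVec h v) A := rfl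

theorem divergence_smul_form (h : Mat4) (v : Fin 4 → ℝ) (A : Mat4)
    (hs : ∀ i j, h i j = h j i) :
    divergence h (fun k => v k • A) = Matrix.vecMul (Matrix.mulVec h v) A := by
  funext j
  simp only [divergence, Matrix.vecMul, Matrix.mulVec, dotProduct, Matrix.smul_apply, smul_eq_mul,
    Finset.sum_mul]
  rw [Finset.sum_comm]
  exact Finset.sum_congr rfl fun i _ => Finset.sum_congr rfl fun a _ => by rw [hs a i]; ring

theorem divergence_add (h : Mat4) (S T : Fin 4 → Mat4) :
    divergence h (S + T) = divergence h S + divergence h T := by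
  funext j
  simp [divergence, mul_add, Finset.sum_add_distrib]

theorem cform_add (g : Mat4) (η : Fin 4 → Fin 4 → Fin 4 → Fin 4 → ℝ) (b κ b' κ' : Fin 4 → ℝ) :
    cform g η (b + b') (κ + κ') = cform g η b κ + cform g η b' κ' := by
  funext k
  simp only [cform, Pi.add_apply, add_smul, Finset.sum_add_distrib]
  abel

theorem cform_smul (g : Mat4) (η : Fin 4 → Fin 4 → Fin 4 → Fin 4 → ℝ) (c : ℝ) (b κ : Fin 4 → ℝ) :
    cform g η (c • b) (c • κ) = c • cform g η b κ := by
  funext k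
  simp only [cform, Pi.smul_apply, smul_add, Finset.smul_sum, smul_smul, smul_eq_mul]

/-- Contractions become matrix traces, so that the product relations of a unitary form apply to
them. -/
theorem contr_eq_neg_trace {h : Mat4} (hs : ∀ i j, h i j = h j i) (A : Mat4) {B : Mat4}
    (hB : ∀ i j, B j i = -B i j) : contr h A B = -(h * A * h * B).trace := by
  simp only [contr_apply, raise, Matrix.of_apply, Matrix.trace, Matrix.diag, Matrix.mul_apply,
    Finset.sum_mul, ← Finset.sum_neg_distrib]
  refine Finset.sum_congr rfl fun i _ => Finset.sum_congr rfl fun j _ => ?_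
  rw [Finset.sum_comm]
  exact Finset.sum_congr rfl fun m _ => Finset.sum_congr rfl fun n _ => by
    rw [hB i j, hs j m]; ring

/-- The algebraic relations between the components of a unitary 2-form `u` and its dual `w`. -/
structure IsUnitaryForm (g h : Mat4) (η : Fin 4 → Fin 4 → Fin 4 → Fin 4 → ℝ) (u w : Mat4) :
    Prop where
  antisymm : ∀ i j, u j i = -u i j
  dual_form : dual h η u = w
  sub_mul : u * h * u - w * h * w = g
  mul_dual : u * h * w = 0
  dual_mul : w * h * u = 0

/-- The algebraic relations between the components of a unitary 2-form `u`, its dual `w`, and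
their covariant derivatives `N` and `M`. -/
structure UnitaryJet (g h : Mat4) (η : Fin 4 → Fin 4 → Fin 4 → Fin 4 → ℝ) (u w : Mat4)
    (N M : Fin 4 → Mat4) : Prop extends IsUnitaryForm g h η u w where
  deriv_antisymm : ∀ k i j, N k j i = -N k i j
  dual_deriv : ∀ k, dual h η (N k) = M k
  contr_deriv : ∀ k, contr h u (N k) = 0
  contr_dual_deriv : ∀ k, contr h w (N k) = 0

namespace IsUnitaryForm

variable {g h : Mat4} {η : Fin 4 → Fin 4 → Fin 4 → Fin 4 → ℝ} {u w : Mat4}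

theorem dual_dual_form (J : IsUnitaryForm g h η u w) (H : IsMetricVolume g h η) :
    dual h η w = -u := by
  rw [← J.dual_form, H.dual_dual J.antisymm]

theorem dual_antisymm (J : IsUnitaryForm g h η u w) (H : IsMetricVolume g h η) (i j : Fin 4) :
    w j i = -w i j := by
  rw [← J.dual_form]; exact H.dual_antisymm u i j

theorem contr_form_dual (J : IsUnitaryForm g h η u w) (H : IsMetricVolume g h η) :
    contr h u w = 0 := by
  have := contr_eq_neg_trace H.inv_symm u (J.dual_antisymm H)
  rw [this, mul_assoc, mul_assoc, ← mul_assoc u, J.mul_dual]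
  simp

theorem contr_dual_dual (J : IsUnitaryForm g h η u w) (H : IsMetricVolume g h η) :
    contr h w w = -contr h u u := by
  have := H.contr_dual u w
  rw [J.dual_dual_form H, J.dual_form, map_neg] at this
  exact this.symm

theorem contr_dual_form (J : IsUnitaryForm g h η u w) (H : IsMetricVolume g h η) :
    contr h w u = 0 := by
  rw [← J.dual_form, ← H.contr_dual, J.dual_form, J.contr_form_dual H]

/-- The trace of $h(uhu-whw)=hg$ gives $-(u,u)+(w,w)=4$, while self-adjointness of the dual gives
$(w,w)=-(u,u)$. -/
theorem contr_form_form (J : IsUnitaryForm g h η u w) (H : IsMetricVolume g h η) :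
    contr h u u = -2 := by
  have h1 := contr_eq_neg_trace H.inv_symm u J.antisymm
  have h2 := contr_eq_neg_trace H.inv_symm w (J.dual_antisymm H)
  have h3 := J.contr_dual_dual H
  have h4 : (h * (u * h * u - w * h * w)).trace = 4 := by
    rw [J.sub_mul, ← H.sum_inv_mul_metric]
    simp only [Matrix.trace, Matrix.diag, Matrix.mul_apply]
    exact Finset.sum_congr rfl fun i _ => Finset.sum_congr rfl fun j _ => by rw [H.metric_symm i j]
  rw [mul_sub, Matrix.trace_sub, ← mul_assoc, ← mul_assoc, ← mul_assoc, ← mul_assoc] at h4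
  linarith

end IsUnitaryForm

variable {g h : Mat4} {η : Fin 4 → Fin 4 → Fin 4 → Fin 4 → ℝ} {u w : Mat4} {N M : Fin 4 → Mat4}

/-- The conformal Killing-Yano equation at one point, for a tensor with canonical elements, in
terms of the covariant derivative of the unitary 2-form and of the differentials `dφ`, `dψ`. -/
theorem UnitaryJet.eq_cform_iff (J : UnitaryJet g h η u w N M) (H : IsMetricVolume g h η)
    (dφ dψ p q Φ Ψ : Fin 4 → ℝ) (hp : p = -divergence h N) (hq : q = -divergence h M)
    (hΦ : Φ = interior h p u - interior h q w) (hΨ : Ψ = -interior h p w - interior h q u) :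
    (∃ b κ, (fun k => N k + dφ k • u + dψ k • w) = cform g η b κ) ↔
      (∀ k, N k - (1 / 2 : ℝ) • (Φ k • u + Ψ k • w)
        - (1 / 2 : ℝ) • cform g η (Matrix.mulVec h p) (-Matrix.mulVec h q) k = 0) ∧
      (-2 : ℝ) • dφ = Φ ∧ (-2 : ℝ) • dψ = Ψ := by
  have hmv : ∀ v, Matrix.mulVec h v = Matrix.vecMul v h := by
    intro v
    funext i
    simp only [Matrix.mulVec, Matrix.vecMul, dotProduct]
    exact Finset.sum_congr rfl fun j _ => by rw [H.inv_symm i j]; ring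
  constructor
  · rintro ⟨b, κ, hX⟩
    have dd := J.toIsUnitaryForm.dual_dual_form H
    have cuu := J.toIsUnitaryForm.contr_form_form H
    have cww := J.toIsUnitaryForm.contr_dual_dual H
    have cuw := J.toIsUnitaryForm.contr_form_dual H
    have cwu := J.toIsUnitaryForm.contr_dual_form H
    -- Contraction with `u` annihilates `N` and `w`, and $(u,u)=-2$ isolates `dφ`; contraction with
    -- `w` isolates `dψ` in the same way.
    have hφ : dφ = -(Matrix.vecMul b u + Matrix.vecMul κ w) := by
      funext k
      have := congrArg (contr h u) (congrFun hX k)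
      simp only [map_add, map_smul, J.contr_deriv, cuu, cuw, H.contr_cform J.antisymm,
        J.dual_form, smul_eq_mul] at this
      simp only [Pi.neg_apply, Pi.add_apply, Matrix.vecMul, dotProduct]
      linarith
    have hψ : dψ = Matrix.vecMul b w - Matrix.vecMul κ u := by
      funext k
      have := congrArg (contr h w) (congrFun hX k)
      simp only [map_add, map_smul, J.contr_dual_deriv, cww, cwu, cuu,
        H.contr_cform (J.toIsUnitaryForm.dual_antisymm H), dd, smul_eq_mul, Matrix.neg_apply, mul_neg,
        Finset.sum_neg_distrib] at this
      simp only [Pi.sub_apply, Matrix.vecMul, dotProduct]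
      linarith
    -- The Hodge dual of the hypothesis. It brings in `M`, whose divergence is `-q`.
    have hY : (fun k => M k + dφ k • w + (-dψ) k • u) = cform g η (-κ) b := by
      funext k
      rw [← H.dual_cform, ← congrFun hX k]
      simp only [map_add, map_smul, J.dual_deriv, J.dual_form, dd, Pi.neg_apply, neg_smul,
        smul_neg]
    have key : ∀ (v : Fin 4 → ℝ) (A B : Mat4), Matrix.vecMul (Matrix.vecMul (Matrix.vecMul v A) h) B
        = Matrix.vecMul v (A * h * B) := by
      intro v A B; simp only [Matrix.vecMul_vecMul]
    have guw : ∀ v, Matrix.vecMul v (u * h * u) = Matrix.vecMul v g + Matrix.vecMul v (w * h * w) := by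
      intro v; rw [← Matrix.vecMul_add, ← J.sub_mul, sub_add_cancel]
    have dc : ∀ b κ, divergence h (cform g η b κ) = (-3 : ℝ) • Matrix.vecMul b g := by
      intro b κ; funext j; exact H.divergence_cform b κ j
    have split : ∀ (T : Fin 4 → Mat4) (f f' : Fin 4 → ℝ) (A A' : Mat4),
        (fun k => T k + f k • A + f' k • A') = T + (fun k => f k • A) + (fun k => f' k • A') :=
      fun _ _ _ _ _ => rfl
    -- In the divergence the terms with `dφ` and `dψ` combine to $-b(uhu-whw)=-bg$, the mixed
    -- products being zero; against $-3bg$ on the right this leaves $2bg$.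
    have hp' : p = (2 : ℝ) • Matrix.vecMul b g := by
      have := congrArg (divergence h) hX
      rw [split, divergence_add, divergence_add, divergence_smul_form _ _ _ H.inv_symm,
        divergence_smul_form _ _ _ H.inv_symm, dc, hmv, hmv, hφ, hψ] at this
      simp only [Matrix.neg_vecMul, Matrix.add_vecMul, Matrix.sub_vecMul, key, J.mul_dual,
        J.dual_mul, Matrix.vecMul_zero, guw] at this
      rw [hp]
      linear_combination (norm := module) (-1 : ℝ) • this
    have hq' : q = (-2 : ℝ) • Matrix.vecMul κ g := by
      have := congrArg (divergence h) hY
      rw [split, divergence_add, divergence_add, divergence_smul_form _ _ _ H.inv_symm,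
        divergence_smul_form _ _ _ H.inv_symm, dc, hmv, hmv, hφ, hψ] at this
      simp only [Matrix.neg_vecMul, Matrix.add_vecMul, Matrix.sub_vecMul, key, J.mul_dual,
        J.dual_mul, Matrix.vecMul_zero, guw] at this
      rw [hq]
      linear_combination (norm := module) (-1 : ℝ) • this
    have hp2 : Matrix.mulVec h p = (2 : ℝ) • b := by
      rw [hp', Matrix.mulVec_smul, H.mulVec_inv_metric]
    have hq2 : Matrix.mulVec h q = (-2 : ℝ) • κ := by
      rw [hq', Matrix.mulVec_smul, H.mulVec_inv_metric]
    have eΦ : (-2 : ℝ) • dφ = Φ := by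
      rw [hΦ, interior_eq_vecMul, interior_eq_vecMul, hp2, hq2, hφ, Matrix.smul_vecMul,
        Matrix.smul_vecMul]
      module
    have eΨ : (-2 : ℝ) • dψ = Ψ := by
      rw [hΨ, interior_eq_vecMul, interior_eq_vecMul, hp2, hq2, hψ, Matrix.smul_vecMul,
        Matrix.smul_vecMul]
      module
    refine ⟨fun k => ?_, eΦ, eΨ⟩
    rw [hp2, hq2, ← neg_smul, neg_neg, cform_smul, ← hX, ← eΦ, ← eΨ]
    simp only [Pi.smul_apply, smul_eq_mul]
    module
  · rintro ⟨hN, eΦ, eΨ⟩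
    -- These parameters are forced by the relations $p=2b$ and $q=-2\kappa$ of the other direction.
    refine ⟨(1 / 2 : ℝ) • Matrix.mulVec h p, (1 / 2 : ℝ) • -Matrix.mulVec h q, ?_⟩
    rw [cform_smul]
    funext k
    rw [← sub_eq_zero, ← hN k, ← eΦ, ← eΨ]
    simp only [Pi.smul_apply, smul_eq_mul]
    module

/-- A duality rotation of a 2-form preserves the conformal Killing-Yano equation. -/
theorem IsMetricVolume.defect_rotation_iff (H : IsMetricVolume g h η)
    {X : Fin 4 → Mat4} (hX : ∀ k i j, X k j i = -X k i j) {r c s : ℝ} (hr : r ≠ 0)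
    (hcs : c ^ 2 + s ^ 2 = 1) :
    (∀ i j k, defect g h (fun k => r • (c • X k + s • dual h η (X k))) i j k = 0) ↔
      ∃ b κ, X = cform g η b κ := by
  constructor
  · intro hd
    obtain ⟨b, κ, hT⟩ := H.exists_eq_cform_of_defect _ (fun k i j => by
      simp only [Matrix.smul_apply, Matrix.add_apply, smul_eq_mul, hX k i j,
        H.dual_antisymm (X k) i j]
      ring) hd
    -- The inverse transformation $r^{-1}(c-s\,*)$ applied to the parameters, with
    -- $*(b,\kappa)=(-\kappa,b)$.
    refine ⟨(c / r) • b + (-s / r) • -κ, (c / r) • κ + (-s / r) • b, ?_⟩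
    rw [cform_add, cform_smul, cform_smul]
    funext k
    have e1 := congrFun hT k
    have e2 := H.dual_cform b κ k
    rw [← e1] at e2
    simp only [map_smul, map_add, H.dual_dual (hX k)] at e2
    simp only [Pi.add_apply, Pi.smul_apply, ← e1, ← e2, smul_smul, smul_add]
    have : c / r * (r * c) + s / r * (r * s) = 1 := by
      field_simp; exact hcs
    calc X k = (c / r * (r * c) + s / r * (r * s)) • X k := by rw [this, one_smul]
      _ = _ := by module
  · rintro ⟨b, κ, rfl⟩ i j k
    have : (fun k => r • (c • cform g η b κ k + s • dual h η (cform g η b κ k)))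
        = cform g η (r • (c • b + s • -κ)) (r • (c • κ + s • b)) := by
      rw [cform_smul, cform_add, cform_smul, cform_smul]
      funext k
      simp only [H.dual_cform, Pi.add_apply, Pi.smul_apply]
    rw [this, H.defect_cform]

end Coord

/-! ### The matrix relations satisfied by $t\wedge s$ and its dual. -/

namespace Coord
namespace IsMetricVolume

variable {g h : Mat4} {η : Fin 4 → Fin 4 → Fin 4 → Fin 4 → ℝ}

/-- The volume element of a time-like plane satisfies the algebraic relations of a unitary
2-form. -/
theorem isUnitaryForm (H : IsMetricVolume g h η) {u : Mat4} (t s : Fin 4 → ℝ)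
    (hu : ∀ i j, u i j = t i * s j - t j * s i)
    (htt : ∑ i, t i * ∑ j, h i j * t j = -1) (hss : ∑ i, s i * ∑ j, h i j * s j = 1)
    (hts : ∑ i, t i * ∑ j, h i j * s j = 0) :
    IsUnitaryForm g h η u (dual h η u) := by
  set T : Fin 4 → ℝ := fun i => ∑ j, h i j * t j with hT
  set S : Fin 4 → ℝ := fun i => ∑ j, h i j * s j with hS
  have lT : ∀ i, ∑ e, T e * g i e = t i := fun i => by
    rw [← H.sum_metric_inv i t]; exact Finset.sum_congr rfl fun e _ => mul_comm _ _
  have lS : ∀ i, ∑ e, S e * g i e = s i := fun i => by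
    rw [← H.sum_metric_inv i s]; exact Finset.sum_congr rfl fun e _ => mul_comm _ _
  have lT' : ∀ i, ∑ e, T e * g e i = t i := fun i => by simp_rw [fun e => H.metric_symm e i, lT]
  have lS' : ∀ i, ∑ e, S e * g e i = s i := fun i => by simp_rw [fun e => H.metric_symm e i, lS]
  have cTT : ∑ e, T e * t e = -1 := by
    rw [← htt]; exact Finset.sum_congr rfl fun e _ => mul_comm _ _
  have cSS : ∑ e, S e * s e = 1 := by
    rw [← hss]; exact Finset.sum_congr rfl fun e _ => mul_comm _ _
  have cSt : ∑ e, S e * t e = 0 := by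
    rw [← hts]; exact Finset.sum_congr rfl fun e _ => mul_comm _ _
  have cTs : ∑ e, T e * s e = 0 := by
    rw [← hts]
    simp only [hT, Finset.sum_mul, Finset.mul_sum]
    rw [Finset.sum_comm]
    exact Finset.sum_congr rfl fun e _ => Finset.sum_congr rfl fun a _ => by
      rw [H.inv_symm e a]; ring
  have hu' : ∀ i j, u j i = -u i j := fun i j => by rw [hu, hu]; ring
  have hR : ∀ k l, raise h u k l = T k * S l - S k * T l := by
    intro k l
    simp only [raise, Matrix.of_apply, hu, hT, hS, Finset.sum_mul_sum, ← Finset.sum_sub_distrib]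
    exact Finset.sum_congr rfl fun e _ => Finset.sum_congr rfl fun a _ => by ring
  have hw : ∀ i j, dual h η u i j = ∑ b, T b * ∑ c, S c * η i j b c := by
    intro i j
    have e1 : ∑ k, ∑ l, η i j k l * (S k * T l) = -∑ k, ∑ l, η i j k l * (T k * S l) := by
      rw [Finset.sum_comm, ← Finset.sum_neg_distrib]
      refine Finset.sum_congr rfl fun k _ => ?_
      rw [← Finset.sum_neg_distrib]
      exact Finset.sum_congr rfl fun l _ => by rw [H.swap₂ i j k l]; ring
    have e2 : ∑ b, T b * ∑ c, S c * η i j b c = ∑ k, ∑ l, η i j k l * (T k * S l) := by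
      simp only [Finset.mul_sum]
      exact Finset.sum_congr rfl fun k _ => Finset.sum_congr rfl fun l _ => by ring
    simp only [dual_apply, hR, mul_sub, Finset.sum_sub_distrib, e1]
    rw [e2]; ring
  -- The dual is $w_{ij}=\eta_{ijbc}T^bS^c$, so contracting it with `S` or `T` puts the same vector
  -- in two slots of `η`; renaming the two summation indices shows that the sum equals its negative.
  have zS : ∀ j, ∑ l, S l * dual h η u l j = 0 := by
    intro j
    have e1 : ∀ l, S l * dual h η u l j = ∑ b, ∑ c, T b * S c * S l * η l j b c := by
      intro l
      rw [hw]; simp only [Finset.mul_sum]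
      exact Finset.sum_congr rfl fun k _ => Finset.sum_congr rfl fun l _ => by ring
    have e2 : ∑ l, ∑ b, ∑ c, T b * S c * S l * η l j b c
        = -∑ l, ∑ b, ∑ c, T b * S c * S l * η l j b c := by
      conv_lhs => rw [Finset.sum_comm]
      conv_rhs => rw [Finset.sum_comm]
      rw [← Finset.sum_neg_distrib]
      refine Finset.sum_congr rfl fun b _ => ?_
      conv_lhs => rw [Finset.sum_comm]
      rw [← Finset.sum_neg_distrib]
      refine Finset.sum_congr rfl fun l _ => ?_
      rw [← Finset.sum_neg_distrib]
      refine Finset.sum_congr rfl fun c _ => ?_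
      rw [H.vol_cycle l j b c, H.swap₂ j b l c, H.vol_cycle c j b l]
      ring
    simp_rw [e1]; linarith
  have zT : ∀ j, ∑ l, T l * dual h η u l j = 0 := by
    intro j
    have e1 : ∀ l, T l * dual h η u l j = ∑ c, ∑ b, T b * S c * T l * η l j b c := by
      intro l
      rw [hw]; simp only [Finset.mul_sum]
      rw [Finset.sum_comm]
      exact Finset.sum_congr rfl fun k _ => Finset.sum_congr rfl fun l _ => by ring
    have e2 : ∑ l, ∑ c, ∑ b, T b * S c * T l * η l j b c
        = -∑ l, ∑ c, ∑ b, T b * S c * T l * η l j b c := by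
      conv_lhs => rw [Finset.sum_comm]
      conv_rhs => rw [Finset.sum_comm]
      rw [← Finset.sum_neg_distrib]
      refine Finset.sum_congr rfl fun c _ => ?_
      conv_lhs => rw [Finset.sum_comm]
      rw [← Finset.sum_neg_distrib]
      refine Finset.sum_congr rfl fun l _ => ?_
      rw [← Finset.sum_neg_distrib]
      refine Finset.sum_congr rfl fun b _ => ?_
      rw [H.swap₀ j l b c, H.swap₁ j b l c, H.swap₀ b j l c]
      ring
    simp_rw [e1]; linarith
  have uh : ∀ i l, (u * h) i l = t i * S l - s i * T l := by
    intro i l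
    simp only [Matrix.mul_apply, hu, hT, hS, Finset.mul_sum, ← Finset.sum_sub_distrib]
    exact Finset.sum_congr rfl fun e _ => by rw [H.inv_symm l e]; ring
  have muldual : u * h * dual h η u = 0 := by
    ext i j
    have : ∀ l, (u * h) i l * dual h η u l j
        = t i * (S l * dual h η u l j) - s i * (T l * dual h η u l j) := by
      intro l; rw [uh]; ring
    rw [Matrix.mul_apply]
    simp only [this, Finset.sum_sub_distrib, ← Finset.mul_sum, zS, zT]
    simp
  refine ⟨hu', rfl, ?_, muldual, ?_⟩
  · ext i j
    have e1 : (u * h * u) i j = -(t i * t j) + s i * s j := by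
      have : ∀ l, (u * h) i l * u l j
        = (S l * t l) * (t i * s j) - (S l * s l) * (t i * t j) - (T l * t l) * (s i * s j)
          + (T l * s l) * (s i * t j) := by
        intro l; rw [uh, hu]; ring
      rw [Matrix.mul_apply]
      simp only [this, Finset.sum_sub_distrib, Finset.sum_add_distrib, ← Finset.sum_mul, cTT, cSS,
        cSt, cTs]
      ring
    -- The product of two volume elements contracted in one index is a Gram determinant of size
    -- three. Contracting it successively with `S`, `T`, `S`, `T` gives $whw=-g-t\otimes t+s\otimes
    -- s$, to be compared with $uhu=-t\otimes t+s\otimes s$.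
    have e2 : (dual h η u * h * dual h η u) i j
        = ∑ b, T b * ∑ c, S c * ∑ d, T d * ∑ e, S e * gram₃ g i b c j d e := by
      have a1 : ∀ b c d e, gram₃ g i b c j d e = ∑ k, ∑ a, h k a * (η i k b c * η a j d e) := by
        intro b c d e
        rw [← neg_inj, ← H.contract_vol_vol, ← Finset.sum_neg_distrib]
        refine Finset.sum_congr rfl fun k _ => ?_
        rw [← Finset.sum_neg_distrib]
        exact Finset.sum_congr rfl fun a _ => by rw [H.swap₀ i k b c]; ring
      have a2 : (dual h η u * h * dual h η u) i j
          = ∑ k, ∑ a, h k a * ∑ b, ∑ c, ∑ d, ∑ e,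
            T b * S c * (T d * S e) * (η i k b c * η a j d e) := by
        simp only [Matrix.mul_apply, Finset.sum_mul]
        rw [Finset.sum_comm]
        refine Finset.sum_congr rfl fun k _ => Finset.sum_congr rfl fun a _ => ?_
        rw [hw, hw]
        simp only [Finset.mul_sum, Finset.sum_mul]
        rw [sum_pair_comm]
        refine Finset.sum_congr rfl fun b _ => ?_
        refine Finset.sum_congr rfl fun c _ => Finset.sum_congr rfl fun d _ =>
          Finset.sum_congr rfl fun e _ => by ring
      have a3 : ∀ F : Fin 4 → Fin 4 → Fin 4 → Fin 4 → Fin 4 → Fin 4 → ℝ,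
          ∑ k, ∑ a, ∑ b, ∑ c, ∑ d, ∑ e, F k a b c d e
            = ∑ b, ∑ c, ∑ d, ∑ e, ∑ k, ∑ a, F k a b c d e := by
        intro F
        rw [sum_pair_comm fun k a b c => ∑ d, ∑ e, F k a b c d e]
        exact Finset.sum_congr rfl fun b _ => Finset.sum_congr rfl fun c _ =>
          sum_pair_comm fun k a d e => F k a b c d e
      rw [a2]
      simp only [a1, Finset.mul_sum]
      rw [a3]
      exact Finset.sum_congr rfl fun b _ => Finset.sum_congr rfl fun c _ =>
        Finset.sum_congr rfl fun d _ => Finset.sum_congr rfl fun e _ =>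
        Finset.sum_congr rfl fun k _ => Finset.sum_congr rfl fun a _ => by ring
    have f1 : ∀ b c d, ∑ e, S e * gram₃ g i b c j d e
        = g i j * (g b d * s c - s b * g c d) - g i d * (g b j * s c - s b * g c j)
          + s i * (g b j * g c d - g b d * g c j) := by
      intro b c d
      have : ∀ e, S e * gram₃ g i b c j d e
        = (S e * g c e) * (g i j * g b d - g i d * g b j)
          + (S e * g b e) * (g i d * g c j - g i j * g c d)
          + (S e * g i e) * (g b j * g c d - g b d * g c j) := by
        intro e; unfold gram₃; ring
      simp only [this, Finset.sum_add_distrib, ← Finset.sum_mul, lS]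
      ring
    have f2 : ∀ b c, ∑ d, T d * (g i j * (g b d * s c - s b * g c d)
          - g i d * (g b j * s c - s b * g c j) + s i * (g b j * g c d - g b d * g c j))
        = g i j * (t b * s c - s b * t c) - t i * (g b j * s c - s b * g c j)
          + s i * (g b j * t c - t b * g c j) := by
      intro b c
      have : ∀ d, T d * (g i j * (g b d * s c - s b * g c d)
          - g i d * (g b j * s c - s b * g c j) + s i * (g b j * g c d - g b d * g c j))
        = (T d * g b d) * (g i j * s c - s i * g c j) + (T d * g c d) * (s i * g b j - g i j * s b)
          + (T d * g i d) * (s b * g c j - g b j * s c) := by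
        intro d; ring
      simp only [this, Finset.sum_add_distrib, ← Finset.sum_mul, lT]
      ring
    have f3 : ∀ b, ∑ c, S c * (g i j * (t b * s c - s b * t c) - t i * (g b j * s c - s b * g c j)
          + s i * (g b j * t c - t b * g c j))
        = g i j * t b - t i * (g b j - s b * s j) - s i * (t b * s j) := by
      intro b
      have : ∀ c, S c * (g i j * (t b * s c - s b * t c) - t i * (g b j * s c - s b * g c j)
          + s i * (g b j * t c - t b * g c j))
        = (S c * s c) * (g i j * t b - t i * g b j) + (S c * t c) * (s i * g b j - g i j * s b)
          + (S c * g c j) * (t i * s b - s i * t b) := by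
        intro c; ring
      simp only [this, Finset.sum_add_distrib, ← Finset.sum_mul, cSS, cSt, lS']
      ring
    have f4 : ∑ b, T b * (g i j * t b - t i * (g b j - s b * s j) - s i * (t b * s j))
        = -g i j - t i * t j + s i * s j := by
      have : ∀ b, T b * (g i j * t b - t i * (g b j - s b * s j) - s i * (t b * s j))
        = (T b * t b) * (g i j - s i * s j) + (T b * s b) * (t i * s j) + (T b * g b j) * (-t i) := by
        intro b; ring
      simp only [this, Finset.sum_add_distrib, ← Finset.sum_mul, cTT, cTs, lT']
      ring
    rw [Matrix.sub_apply, e1, e2]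
    simp only [f1, f2, f3, f4]
    ring
  -- The relation $whu=0$ is the transpose of $uhw=0$, since `u` and `w` are skew and `h` is
  -- symmetric.
  · have tr : ∀ A : Mat4, (∀ i j, A j i = -A i j) → A.transpose = -A := by
      intro A hA; ext i j; exact hA i j
    have th : h.transpose = h := by ext i j; exact H.inv_symm j i
    have := congrArg Matrix.transpose muldual
    rw [Matrix.transpose_mul, Matrix.transpose_mul, tr _ hu', th, tr _ (H.dual_antisymm u)] at this
    simpa [mul_assoc] using this

end IsMetricVolume
end Coord

/-! ### Partial derivatives of matrices and determinants; the sign symbol. -/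

namespace Coord

section PartialDerivative

variable {F : Type} [NormedField F] [NormedAlgebra ℝ F] {f f' : E4 → F} {y : E4}

theorem pd_congr (k : Fin 4) (h : f =ᶠ[nhds y] f') : pd k f y = pd k f' y := by
  rw [pd, pd, h.fderiv_eq]

theorem pd_const (k : Fin 4) (c : F) : pd k (fun _ => c) y = 0 := by
  simp [pd]

theorem pd_add (k : Fin 4) (hf : DifferentiableAt ℝ f y) (hf' : DifferentiableAt ℝ f' y) :
    pd k (fun z => f z + f' z) y = pd k f y + pd k f' y := by
  simp [pd, fderiv_fun_add hf hf']

theorem pd_mul (k : Fin 4) (hf : DifferentiableAt ℝ f y) (hf' : DifferentiableAt ℝ f' y) :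
    pd k (fun z => f z * f' z) y = pd k f y * f' y + f y * pd k f' y := by
  simp [pd, fderiv_fun_mul hf hf']; ring

theorem pd_sum (k : Fin 4) {f : Fin 4 → E4 → F} (hf : ∀ i, DifferentiableAt ℝ (f i) y) :
    pd k (fun z => ∑ i, f i z) y = ∑ i, pd k (f i) y := by
  simp [pd, fderiv_fun_sum fun i _ => hf i]

theorem pd_clm {F' : Type} [NormedField F'] [NormedAlgebra ℝ F'] (k : Fin 4) (ℓ : F →L[ℝ] F')
    (hf : DifferentiableAt ℝ f y) : pd k (fun z => ℓ (f z)) y = ℓ (pd k f y) := by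
  have := (ℓ.hasFDerivAt.comp y hf.hasFDerivAt).fderiv
  rw [pd, pd, show (fun z => ℓ (f z)) = ℓ ∘ f from rfl, this]
  rfl

end PartialDerivative

/-- The matrix of partial derivatives of the entries of a matrix. -/
def pdM (k : Fin 4) (A : E4 → Mat4) (y : E4) : Mat4 := Matrix.of fun i j => pd k (fun z => A z i j) y

/-- Differentiability of all the entries of a matrix. -/
def DiffM (A : E4 → Mat4) (y : E4) : Prop := ∀ i j, DifferentiableAt ℝ (fun z => A z i j) y

section Matrix

variable {A B : E4 → Mat4} {y : E4}

theorem DiffM.mul (hA : DiffM A y) (hB : DiffM B y) : DiffM (fun z => A z * B z) y := by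
  intro i j
  simp only [Matrix.mul_apply]
  exact DifferentiableAt.fun_sum fun l _ => (hA i l).fun_mul (hB l j)

theorem pdM_mul (k : Fin 4) (hA : DiffM A y) (hB : DiffM B y) :
    pdM k (fun z => A z * B z) y = pdM k A y * B y + A y * pdM k B y := by
  ext i j
  simp only [pdM, Matrix.of_apply, Matrix.mul_apply, Matrix.add_apply]
  rw [pd_sum k fun l => (hA i l).fun_mul (hB l j), ← Finset.sum_add_distrib]
  exact Finset.sum_congr rfl fun l _ => pd_mul k (hA i l) (hB l j)

theorem pdM_congr (k : Fin 4) (h : A =ᶠ[nhds y] B) : pdM k A y = pdM k B y := by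
  ext i j
  exact pd_congr k (h.mono fun z hz => by simp only [hz])

/-- The product rule applied to each term of the Leibniz expansion. The derivative is kept explicit
so that it can be regrouped column by column in Jacobi's formula. -/
theorem DiffM.hasFDerivAt_det (hA : DiffM A y) :
    HasFDerivAt (fun z => (A z).det) (∑ σ : Equiv.Perm (Fin 4), ((Equiv.Perm.sign σ : ℤ) : ℝ) •
      ∑ i, (∏ j ∈ Finset.univ.erase i, A y (σ j) j) • fderiv ℝ (fun z => A z (σ i) i) y) y := by
  simp only [Matrix.det_apply']
  refine HasFDerivAt.fun_sum fun σ _ => HasFDerivAt.const_mul ?_ _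
  exact HasFDerivAt.finsetProd fun i _ => (hA (σ i) i).hasFDerivAt

theorem DiffM.det (hA : DiffM A y) : DifferentiableAt ℝ (fun z => (A z).det) y :=
  hA.hasFDerivAt_det.differentiableAt

/-- Jacobi's formula for the derivative of a determinant. -/
theorem pd_det (k : Fin 4) (hA : DiffM A y) :
    pd k (fun z => (A z).det) y = ((A y).adjugate * pdM k A y).trace := by
  have e1 : pd k (fun z => (A z).det) y = ∑ σ : Equiv.Perm (Fin 4), ((Equiv.Perm.sign σ : ℤ) : ℝ) *
      ∑ i, (∏ j ∈ Finset.univ.erase i, A y (σ j) j) * pdM k A y (σ i) i := by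
    rw [pd, hA.hasFDerivAt_det.fderiv]
    simp [pdM, pd]
  -- By Cramer's rule this diagonal entry is the determinant of `A` with column `i` replaced by its
  -- derivative.
  have e2 : ∀ i, ((A y).adjugate * pdM k A y) i i
      = ∑ σ : Equiv.Perm (Fin 4), ((Equiv.Perm.sign σ : ℤ) : ℝ) *
      ((∏ j ∈ Finset.univ.erase i, A y (σ j) j) * pdM k A y (σ i) i) := by
    intro i
    have : ((A y).adjugate * pdM k A y) i i
        = ((A y).updateCol i fun j => pdM k A y j i).det := by
      rw [← Matrix.cramer_apply, Matrix.cramer_eq_adjugate_mulVec]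
      rfl
    rw [this, Matrix.det_apply']
    refine Finset.sum_congr rfl fun σ _ => ?_
    rw [← Finset.prod_erase_mul _ _ (Finset.mem_univ i), Matrix.updateCol_self]
    congr 2
    exact Finset.prod_congr rfl fun j hj => Matrix.updateCol_ne (Finset.ne_of_mem_erase hj)
  simp only [Matrix.trace, Matrix.diag, e2]
  rw [e1, Finset.sum_comm]
  exact Finset.sum_congr rfl fun σ _ => Finset.mul_sum _ _ _

theorem DiffM.inv (hA : DiffM A y) (h0 : (A y).det ≠ 0) : DiffM (fun z => (A z)⁻¹) y := by
  intro i j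
  simp only [Matrix.inv_def, Matrix.smul_apply, smul_eq_mul, Ring.inverse_eq_inv',
    Matrix.adjugate_apply]
  refine (hA.det.inv h0).mul (DiffM.det fun a b => ?_)
  by_cases h : a = j
  · subst h; simp
  · simpa [Matrix.updateRow_ne h] using hA a b

/-- Differentiate $AA^{-1}=1$. Invertibility is needed in a neighbourhood, because the identity is
differentiated there. -/
theorem pdM_inv (k : Fin 4) (hA : DiffM A y) (h0 : ∀ᶠ z in nhds y, (A z).det ≠ 0) :
    pdM k (fun z => (A z)⁻¹) y = -((A y)⁻¹ * pdM k A y * (A y)⁻¹) := by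
  have hi := hA.inv h0.self_of_nhds
  have e : pdM k (fun z => A z * (A z)⁻¹) y = 0 := by
    rw [pdM_congr k (B := fun _ => 1) (h0.mono fun z hz =>
      Matrix.mul_nonsing_inv _ (isUnit_iff_ne_zero.2 hz))]
    ext i j
    exact pd_const k _
  rw [pdM_mul k hA hi] at e
  have hu : (A y)⁻¹ * A y = 1 := Matrix.nonsing_inv_mul _ (isUnit_iff_ne_zero.2 h0.self_of_nhds)
  have := congrArg (fun X => (A y)⁻¹ * X) e
  simp only [mul_add, mul_zero, ← mul_assoc, hu, one_mul] at this
  exact eq_neg_of_add_eq_zero_right this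

end Matrix

/-- The sign symbol of four indices, as a determinant. -/
def levi (v : Fin 4 → Fin 4) : ℝ := ((1 : Mat4).submatrix v id).det

theorem levi_swap (v : Fin 4 → Fin 4) {i j : Fin 4} (h : i ≠ j) :
    levi (v ∘ Equiv.swap i j) = -levi v := by
  have := Matrix.det_permute (Equiv.swap i j) ((1 : Mat4).submatrix v id)
  rw [Equiv.Perm.sign_swap h] at this
  simpa [levi] using this

/-- Selecting rows and columns is multiplication by selection matrices on both sides, whose
determinants are the sign symbols; repeated indices are included. -/
theorem levi_mul_det_mul_levi (g : Mat4) (v w : Fin 4 → Fin 4) :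
    levi v * g.det * levi w = (g.submatrix v w).det := by
  have : g.submatrix v w = (1 : Mat4).submatrix v id * g * ((1 : Mat4).submatrix w id).transpose := by
    ext i j
    simp [Matrix.mul_apply, Matrix.one_apply]
  rw [this, Matrix.det_mul, Matrix.det_mul, Matrix.det_transpose]
  rfl

/-- The derivation of the sign symbol induced by an endomorphism is multiplication by the trace. -/
theorem sum_levi_update (G : Mat4) (v : Fin 4 → Fin 4) :
    ∑ r, ∑ a, G a (v r) * levi (Function.update v r a) = G.trace * levi v := by
  set R : Mat4 := (1 : Mat4).submatrix v id with hR
  -- Replacing the index in slot `r` by `a` replaces row `r` of the selection matrix by a unit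
  -- vector, which is an adjugate entry. The double sum becomes
  -- $\operatorname{tr}(RG^{T}\operatorname{adj}R)=\operatorname{tr}G\cdot\det R$.
  have e : ∀ r a, levi (Function.update v r a) = R.adjugate a r := by
    intro r a
    rw [Matrix.adjugate_apply, levi]
    congr 1
    ext i j
    by_cases hi : i = r
    · subst hi; simp [Matrix.one_apply, Pi.single_apply, eq_comm]
    · rw [Matrix.updateRow_ne hi, Matrix.submatrix_apply, Function.update_of_ne hi]
      rfl
  have e2 : ∀ r a, G a (v r) = (R * G.transpose) r a := by
    intro r a
    simp [hR, Matrix.mul_apply, Matrix.one_apply]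
  have : ∑ r, ∑ a, G a (v r) * levi (Function.update v r a)
      = (R * G.transpose * R.adjugate).trace := by
    simp only [e, e2, Matrix.trace, Matrix.diag, Matrix.mul_apply (M := R * G.transpose)]
  rw [this, Matrix.trace_mul_comm, ← mul_assoc, Matrix.adjugate_mul]
  simp [levi, hR, mul_comm]

end Coord

/-! ### The metric, the volume element and the Hodge dual are parallel. -/

namespace Coord

/-- `g` and `η` are the components of a differentiable Lorentzian metric and of its volume element
near the point `y`. -/
structure IsLocalSpacetime (g : E4 → Mat4) (η : E4 → Fin 4 → Fin 4 → Fin 4 → Fin 4 → ℝ) (y : E4) :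
    Prop where
  diff : DiffM g y
  symm : ∀ᶠ z in nhds y, ∀ i j, g z i j = g z j i
  exists_vol : ∃ f : E4 → ℝ, DifferentiableAt ℝ f y ∧ ∀ᶠ z in nhds y,
    f z ^ 2 = -(g z).det ∧ f z ≠ 0 ∧ ∀ i j k l, η z i j k l = f z * levi ![i, j, k, l]

/-- The Christoffel symbols `Γ^l_{ki}` with a fixed index `k`. -/
def christoffelM (g : E4 → Mat4) (y : E4) (k : Fin 4) : Mat4 :=
  Matrix.of fun l i => christoffel g y l k i

/-- The components of the covariant derivative in the direction `k`. -/
def nablaM (g : E4 → Mat4) (A : E4 → Mat4) (y : E4) (k : Fin 4) : Mat4 :=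
  Matrix.of fun i j => nabla g A y k i j

/-- In matrix form the Leibniz rules below reduce to identities in a noncommutative ring. -/
theorem nablaM_eq (g : E4 → Mat4) (A : E4 → Mat4) (y : E4) (k : Fin 4) :
    nablaM g A y k = pdM k A y - (christoffelM g y k).transpose * A y
      - A y * christoffelM g y k := by
  ext i j
  simp only [nablaM, nabla, pdM, christoffelM, Matrix.sub_apply, Matrix.mul_apply,
    Matrix.transpose_apply, Matrix.of_apply, smul_eq_mul]
  congr 1
  exact Finset.sum_congr rfl fun l _ => mul_comm _ _

theorem raise_eq_mul {h : Mat4} (hs : ∀ i j, h i j = h j i) (A : Mat4) :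
    raise h A = h * A * h := by
  ext k l
  simp only [raise, Matrix.of_apply, Matrix.mul_apply, Finset.sum_mul]
  rw [Finset.sum_comm]
  exact Finset.sum_congr rfl fun m _ => Finset.sum_congr rfl fun n _ => by rw [hs l m]; ring

theorem contr_eq_trace (h A B : Mat4) : contr h A B = ((raise h A).transpose * B).trace := by
  simp only [contr_apply, Matrix.trace, Matrix.diag, Matrix.mul_apply, Matrix.transpose_apply]
  exact Finset.sum_comm

namespace IsLocalSpacetime

variable {g : E4 → Mat4} {η : E4 → Fin 4 → Fin 4 → Fin 4 → Fin 4 → ℝ} {y : E4}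

/-- Writing $\eta=f\cdot\mathrm{levi}$ with $f^2=-\det g$ turns a product of two components into
minus a Gram determinant. -/
theorem eventually_isMetricVolume (L : IsLocalSpacetime g η y) :
    ∀ᶠ z in nhds y, IsMetricVolume (g z) (g z)⁻¹ (η z) ∧ (g z).det ≠ 0 := by
  obtain ⟨f, -, hf⟩ := L.exists_vol
  filter_upwards [L.symm, hf] with z hs ⟨h1, h2, h3⟩
  have hdet : (g z).det ≠ 0 := by
    intro h0
    rw [h0, neg_zero] at h1
    exact h2 (pow_eq_zero_iff two_ne_zero |>.1 h1)
  have ht : (g z).transpose = g z := by ext i j; exact hs j i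
  refine ⟨⟨hs, fun i j => ?_, fun i j => ?_, fun a b c d i j k l => ?_, fun i j k l => ?_,
    fun i j k l => ?_, fun i j k l => ?_⟩, hdet⟩
  · have := congrFun (congrFun (Matrix.transpose_nonsing_inv (g z)) j) i
    rw [ht] at this
    exact this
  · have := congrFun (congrFun (Matrix.nonsing_inv_mul (g z) (isUnit_iff_ne_zero.2 hdet)) i) j
    rw [Matrix.mul_apply, Matrix.one_apply] at this
    exact this
  · rw [h3, h3, ← levi_mul_det_mul_levi]
    linear_combination (levi ![a, b, c, d] * levi ![i, j, k, l]) * h1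
  · rw [h3, h3, ← mul_neg, ← levi_swap _ (i := 0) (j := 1) (by decide)]
    congr 2
    ext r; fin_cases r <;> rfl
  · rw [h3, h3, ← mul_neg, ← levi_swap _ (i := 1) (j := 2) (by decide)]
    congr 2
    ext r; fin_cases r <;> rfl
  · rw [h3, h3, ← mul_neg, ← levi_swap _ (i := 2) (j := 3) (by decide)]
    congr 2
    ext r; fin_cases r <;> rfl

theorem isMetricVolume (L : IsLocalSpacetime g η y) : IsMetricVolume (g y) (g y)⁻¹ (η y) :=
  L.eventually_isMetricVolume.self_of_nhds.1

theorem det_ne_zero (L : IsLocalSpacetime g η y) : (g y).det ≠ 0 :=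
  L.eventually_isMetricVolume.self_of_nhds.2

theorem pd_symm (L : IsLocalSpacetime g η y) (k i j : Fin 4) :
    pd k (fun z => g z i j) y = pd k (fun z => g z j i) y :=
  pd_congr k (L.symm.mono fun _ hz => hz i j)

theorem christoffel_symm (L : IsLocalSpacetime g η y) (k i j : Fin 4) :
    christoffel g y k i j = christoffel g y k j i := by
  simp only [christoffel]
  congr 1
  refine Finset.sum_congr rfl fun l _ => ?_
  rw [L.pd_symm l i j]; ring

theorem metric_mul_christoffel (L : IsLocalSpacetime g η y) (k i j : Fin 4) :
    (g y * christoffelM g y k) j i = (1 / 2) * (pd k (fun z => g z i j) y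
      + pd i (fun z => g z k j) y - pd j (fun z => g z k i) y) := by
  rw [← L.isMetricVolume.sum_metric_inv j fun l => (1 / 2) * (pd k (fun z => g z i l) y
      + pd i (fun z => g z k l) y - pd l (fun z => g z k i) y)]
  rw [Matrix.mul_apply]
  refine Finset.sum_congr rfl fun l _ => ?_
  simp only [christoffelM, Matrix.of_apply, christoffel, Finset.mul_sum]
  exact Finset.sum_congr rfl fun m _ => by ring

/-- The metric is parallel. -/
theorem pdM_metric (L : IsLocalSpacetime g η y) (k : Fin 4) :
    pdM k g y = (christoffelM g y k).transpose * g y + g y * christoffelM g y k := by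
  have hs : (g y).transpose = g y := by ext i j; exact L.isMetricVolume.metric_symm j i
  ext i j
  have e : ((christoffelM g y k).transpose * g y) i j = (g y * christoffelM g y k) j i := by
    conv_lhs => rw [← hs, ← Matrix.transpose_mul]
    rfl
  rw [Matrix.add_apply, e, L.metric_mul_christoffel, L.metric_mul_christoffel, pdM,
    Matrix.of_apply, L.pd_symm k j i]
  ring

theorem inv_mul_metric (L : IsLocalSpacetime g η y) : (g y)⁻¹ * g y = 1 :=
  Matrix.nonsing_inv_mul _ (isUnit_iff_ne_zero.2 L.det_ne_zero)

theorem metric_mul_inv (L : IsLocalSpacetime g η y) : g y * (g y)⁻¹ = 1 :=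
  Matrix.mul_nonsing_inv _ (isUnit_iff_ne_zero.2 L.det_ne_zero)

theorem pdM_inv_metric (L : IsLocalSpacetime g η y) (k : Fin 4) :
    pdM k (fun z => (g z)⁻¹) y
      = -((g y)⁻¹ * (christoffelM g y k).transpose + christoffelM g y k * (g y)⁻¹) := by
  rw [pdM_inv k L.diff (L.eventually_isMetricVolume.mono fun _ h => h.2), L.pdM_metric,
    mul_add, add_mul, ← mul_assoc, ← mul_assoc, L.inv_mul_metric, one_mul, mul_assoc, mul_assoc,
    L.metric_mul_inv, mul_one]

/-- The volume element is parallel. -/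
theorem pd_vol (L : IsLocalSpacetime g η y) (k i j l m : Fin 4) :
    DifferentiableAt ℝ (fun z => η z i j l m) y ∧
    pd k (fun z => η z i j l m) y = ∑ a, christoffelM g y k a i * η y a j l m
      + ∑ a, christoffelM g y k a j * η y i a l m + ∑ a, christoffelM g y k a l * η y i j a m
      + ∑ a, christoffelM g y k a m * η y i j l a := by
  obtain ⟨f, hf, hev⟩ := L.exists_vol
  obtain ⟨h1, h2, h3⟩ := hev.self_of_nhds
  set G := christoffelM g y k with hG
  have hη : (fun z => η z i j l m) =ᶠ[nhds y] fun z => f z * levi ![i, j, l, m] :=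
    hev.mono fun z hz => hz.2.2 i j l m
  refine ⟨(hf.mul_const _).congr_of_eventuallyEq hη, ?_⟩
  have hdet : pd k (fun z => (g z).det) y = 2 * (g y).det * G.trace := by
    rw [pd_det k L.diff, L.pdM_metric, ← hG, mul_add, Matrix.trace_add,
      ← mul_assoc (g y).adjugate (g y), Matrix.adjugate_mul,
      Matrix.trace_mul_comm _ (G.transpose * g y), mul_assoc, Matrix.mul_adjugate]
    simp
    ring
  -- Differentiating $f^2=-\det g$ avoids choosing a square root; with Jacobi's formula and division
  -- by $f\ne0$ it gives $\partial_kf=f\operatorname{tr}\Gamma_k$. The trace identity for the sign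
  -- symbol then spreads this trace over the four index slots.
  have hf2 : pd k (fun z => f z * f z) y = -pd k (fun z => (g z).det) y := by
    rw [pd_congr k (f' := fun z => -(g z).det) (hev.mono fun z hz => by
      simp only [← hz.1]; ring)]
    simp [pd]
  rw [pd_mul k hf hf, hdet] at hf2
  have hpf : pd k f y = f y * G.trace := by
    have : f y * (pd k f y - f y * G.trace) = 0 := by linear_combination hf2 / 2 - G.trace * h1
    have := (mul_eq_zero.1 this).resolve_left h2
    linarith
  rw [pd_congr k hη, pd_mul k hf (differentiableAt_const _), pd_const, hpf]
  have key := sum_levi_update G ![i, j, l, m]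
  have u0 : ∀ a, Function.update ![i, j, l, m] 0 a = ![a, j, l, m] := by
    intro a; ext r; fin_cases r <;> rfl
  have u1 : ∀ a, Function.update ![i, j, l, m] 1 a = ![i, a, l, m] := by
    intro a; ext r; fin_cases r <;> rfl
  have u2 : ∀ a, Function.update ![i, j, l, m] 2 a = ![i, j, a, m] := by
    intro a; ext r; fin_cases r <;> rfl
  have u3 : ∀ a, Function.update ![i, j, l, m] 3 a = ![i, j, l, a] := by
    intro a; ext r; fin_cases r <;> rfl
  rw [Fin.sum_univ_four] at key
  simp only [u0, u1, u2, u3, Matrix.cons_val] at key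
  have pull : ∀ (x : Fin 4) (v : Fin 4 → Fin 4 → Fin 4),
      ∑ a, G a x * (f y * levi (v a)) = f y * ∑ a, G a x * levi (v a) := by
    intro x v
    rw [Finset.mul_sum]
    exact Finset.sum_congr rfl fun a _ => by ring
  simp only [h3, pull i fun a => ![a, j, l, m], pull j fun a => ![i, a, l, m],
    pull l fun a => ![i, j, a, m], pull m fun a => ![i, j, l, a]]
  linear_combination (-f y) * key

theorem diffM_inv (L : IsLocalSpacetime g η y) : DiffM (fun z => (g z)⁻¹) y :=
  L.diff.inv L.det_ne_zero

variable {A B : E4 → Mat4}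

theorem raise_eventuallyEq (L : IsLocalSpacetime g η y) (A : E4 → Mat4) :
    (fun z => raise (g z)⁻¹ (A z)) =ᶠ[nhds y] fun z => (g z)⁻¹ * A z * (g z)⁻¹ :=
  L.eventually_isMetricVolume.mono fun _ hz => raise_eq_mul hz.1.inv_symm _

theorem diffM_raise (L : IsLocalSpacetime g η y) (hA : DiffM A y) :
    DiffM (fun z => raise (g z)⁻¹ (A z)) y := by
  intro i j
  refine (((L.diffM_inv.mul hA).mul L.diffM_inv) i j).congr_of_eventuallyEq ?_
  exact (L.raise_eventuallyEq A).mono fun z hz => by simp only [hz]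

theorem pdM_raise (L : IsLocalSpacetime g η y) (hA : DiffM A y) (k : Fin 4) :
    pdM k (fun z => raise (g z)⁻¹ (A z)) y = raise (g y)⁻¹ (nablaM g A y k)
      - christoffelM g y k * raise (g y)⁻¹ (A y)
      - raise (g y)⁻¹ (A y) * (christoffelM g y k).transpose := by
  rw [pdM_congr k (L.raise_eventuallyEq A), pdM_mul k (L.diffM_inv.mul hA) L.diffM_inv,
    pdM_mul k L.diffM_inv hA, L.pdM_inv_metric, raise_eq_mul L.isMetricVolume.inv_symm,
    raise_eq_mul L.isMetricVolume.inv_symm, nablaM_eq]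
  noncomm_ring

theorem diffM_dual (L : IsLocalSpacetime g η y) (hA : DiffM A y) :
    DiffM (fun z => dual (g z)⁻¹ (η z) (A z)) y := by
  intro i j
  simp only [dual_apply]
  refine DifferentiableAt.const_mul (DifferentiableAt.fun_sum fun k _ =>
    DifferentiableAt.fun_sum fun l _ => ?_) _
  exact (L.pd_vol 0 i j k l).1.fun_mul (L.diffM_raise hA k l)

/-- The Hodge duality commutes with the covariant derivative. -/
theorem nablaM_dual (L : IsLocalSpacetime g η y) (hA : DiffM A y) (k : Fin 4) :
    nablaM g (fun z => dual (g z)⁻¹ (η z) (A z)) y k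
      = dual (g y)⁻¹ (η y) (nablaM g A y k) := by
  rw [nablaM_eq]
  set G := christoffelM g y k with hG
  set R := raise (g y)⁻¹ (A y) with hR
  ext i j
  have e1 : pdM k (fun z => dual (g z)⁻¹ (η z) (A z)) y i j
      = (1 / 2) * ∑ p, ∑ q, (pd k (fun z => η z i j p q) y * R p q
        + η y i j p q * pdM k (fun z => raise (g z)⁻¹ (A z)) y p q) := by
    have d : ∀ p q, DifferentiableAt ℝ (fun z => η z i j p q * raise (g z)⁻¹ (A z) p q) y :=
      fun p q => (L.pd_vol 0 i j p q).1.fun_mul (L.diffM_raise hA p q)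
    simp only [pdM, Matrix.of_apply, dual_apply]
    rw [pd_mul k (differentiableAt_const _) (DifferentiableAt.fun_sum fun p _ =>
      DifferentiableAt.fun_sum fun q _ => d p q), pd_const, zero_mul, zero_add,
      pd_sum k fun p => DifferentiableAt.fun_sum fun q _ => d p q]
    congr 1
    refine Finset.sum_congr rfl fun p _ => ?_
    rw [pd_sum k fun q => d p q]
    exact Finset.sum_congr rfl fun q _ =>
      pd_mul k (L.pd_vol 0 i j p q).1 (L.diffM_raise hA p q)
  -- In `t1` and `t2` the connection terms of `η` on the summed indices match those of the raised
  -- tensor and will cancel; in `t3` and `t4` the terms on `i` and `j` become the connection terms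
  -- of the dual.
  have t1 : ∑ p, ∑ q, (∑ a, G a p * η y i j a q) * R p q
      = ∑ p, ∑ q, η y i j p q * ∑ a, G p a * R a q := by
    simp only [Finset.sum_mul, Finset.mul_sum]
    conv_lhs =>
      rw [Finset.sum_comm]
      enter [2, q]
      rw [Finset.sum_comm]
    rw [Finset.sum_comm]
    exact Finset.sum_congr rfl fun p _ => Finset.sum_congr rfl fun q _ =>
      Finset.sum_congr rfl fun a _ => by ring
  have t2 : ∑ p, ∑ q, (∑ a, G a q * η y i j p a) * R p q
      = ∑ p, ∑ q, η y i j p q * ∑ a, R p a * G q a := by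
    simp only [Finset.sum_mul, Finset.mul_sum]
    refine Finset.sum_congr rfl fun p _ => ?_
    rw [Finset.sum_comm]
    exact Finset.sum_congr rfl fun q _ => Finset.sum_congr rfl fun a _ => by ring
  have t3 : ∑ p, ∑ q, (∑ a, G a i * η y a j p q) * R p q
      = 2 * (G.transpose * dual (g y)⁻¹ (η y) (A y)) i j := by
    simp only [Matrix.mul_apply, Matrix.transpose_apply, dual_apply, Finset.sum_mul,
      Finset.mul_sum, ← hR]
    rw [Finset.sum_comm]
    conv_rhs => rw [Finset.sum_comm]
    conv_lhs => rw [Finset.sum_comm]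
    refine Finset.sum_congr rfl fun p _ => ?_
    conv_rhs => rw [Finset.sum_comm]
    exact Finset.sum_congr rfl fun q _ => Finset.sum_congr rfl fun a _ => by ring
  have t4 : ∑ p, ∑ q, (∑ a, G a j * η y i a p q) * R p q
      = 2 * (dual (g y)⁻¹ (η y) (A y) * G) i j := by
    simp only [Matrix.mul_apply, dual_apply, Finset.sum_mul, Finset.mul_sum, ← hR]
    conv_rhs => rw [Finset.sum_comm]
    refine Finset.sum_congr rfl fun p _ => ?_
    conv_rhs => rw [Finset.sum_comm]
    exact Finset.sum_congr rfl fun q _ => Finset.sum_congr rfl fun a _ => by ring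
  have t5 : ∀ p q, pd k (fun z => η z i j p q) y * R p q
        + η y i j p q * pdM k (fun z => raise (g z)⁻¹ (A z)) y p q
      = (∑ a, G a i * η y a j p q) * R p q + (∑ a, G a j * η y i a p q) * R p q
        + ((∑ a, G a p * η y i j a q) * R p q - η y i j p q * ∑ a, G p a * R a q)
        + ((∑ a, G a q * η y i j p a) * R p q - η y i j p q * ∑ a, R p a * G q a)
        + η y i j p q * raise (g y)⁻¹ (nablaM g A y k) p q := by
    intro p q
    rw [(L.pd_vol k i j p q).2, L.pdM_raise hA, ← hG, ← hR]
    simp only [Matrix.sub_apply, Matrix.mul_apply, Matrix.transpose_apply]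
    ring
  simp only [Matrix.sub_apply, e1, t5, Finset.sum_add_distrib, Finset.sum_sub_distrib, t1, t2, t3,
    t4]
  rw [dual_apply _ _ (nablaM g A y k)]
  ring

/-- The contraction of two tensors satisfies the Leibniz rule. -/
theorem pd_contr (L : IsLocalSpacetime g η y) (hA : DiffM A y) (hB : DiffM B y) (k : Fin 4) :
    pd k (fun z => contr (g z)⁻¹ (A z) (B z)) y
      = contr (g y)⁻¹ (nablaM g A y k) (B y) + contr (g y)⁻¹ (A y) (nablaM g B y k) := by
  have hR := L.diffM_raise hA
  set R : E4 → Mat4 := fun z => raise (g z)⁻¹ (A z) with hRdef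
  have e1 : pd k (fun z => contr (g z)⁻¹ (A z) (B z)) y
      = ((pdM k R y).transpose * B y).trace + ((R y).transpose * pdM k B y).trace := by
    have d : ∀ i j, DifferentiableAt ℝ (fun z => R z i j * B z i j) y :=
      fun i j => (hR i j).fun_mul (hB i j)
    simp only [contr_apply]
    rw [pd_sum k fun p => DifferentiableAt.fun_sum fun q _ => d p q]
    simp only [Matrix.trace, Matrix.diag, Matrix.mul_apply, Matrix.transpose_apply]
    rw [Finset.sum_comm (f := fun i j => pdM k R y j i * B y j i),
      Finset.sum_comm (f := fun i j => R y j i * pdM k B y j i), ← Finset.sum_add_distrib]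
    refine Finset.sum_congr rfl fun p _ => ?_
    rw [pd_sum k fun q => d p q, ← Finset.sum_add_distrib]
    exact Finset.sum_congr rfl fun q _ => pd_mul k (hR p q) (hB p q)
  have e2 : pdM k B y = nablaM g B y k + (christoffelM g y k).transpose * B y
      + B y * christoffelM g y k := by
    rw [nablaM_eq]; abel
  rw [e1, e2, L.pdM_raise hA, contr_eq_trace, contr_eq_trace]
  simp only [Matrix.transpose_sub, Matrix.transpose_mul, Matrix.transpose_transpose, sub_mul,
    mul_add, Matrix.trace_sub, Matrix.trace_add]
  -- Cyclicity of the trace makes the connection terms of the two factors cancel.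
  rw [mul_assoc (christoffelM g y k), Matrix.trace_mul_comm (christoffelM g y k)]
  simp only [hRdef, mul_assoc]
  ring

end IsLocalSpacetime
end Coord

/-! ### The codifferential as minus the divergence; splitting complex operators. -/

namespace Coord

theorem sum_cycle (F : Fin 4 → Fin 4 → Fin 4 → ℝ) :
    ∑ i, ∑ j, ∑ k, F i j k = ∑ i, ∑ j, ∑ k, F k i j := by
  conv_rhs =>
    enter [2, i]
    rw [Finset.sum_comm]
  conv_rhs => rw [Finset.sum_comm]

/-- The Hodge dual of a field of 2-forms, with values in the matrices. -/
def starM (g : E4 → Mat4) (η : E4 → Fin 4 → Fin 4 → Fin 4 → Fin 4 → ℝ) (A : E4 → Mat4) (y : E4) :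
    Mat4 := dual (g y)⁻¹ (η y) (A y)

theorem star_eq_dual (g : E4 → Mat4) (η : E4 → Fin 4 → Fin 4 → Fin 4 → Fin 4 → ℝ)
    (A : E4 → Mat4) : star g η A = fun z => dual (g z)⁻¹ (η z) (A z) := rfl

/-- The third contravariant components of a tensor with three indices, contracted with the volume
element in three indices. -/
def contrVol (h : Mat4) (η : Fin 4 → Fin 4 → Fin 4 → Fin 4 → ℝ) (l : Fin 4)
    (X : Fin 4 → Fin 4 → Fin 4 → ℝ) : ℝ :=
  ∑ i, ∑ j, ∑ k, η i j k l * ∑ a, ∑ b, ∑ c, (h i a * h j b * h k c) * X a b c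

theorem contrVol_add (h : Mat4) (η : Fin 4 → Fin 4 → Fin 4 → Fin 4 → ℝ) (l : Fin 4)
    (X Y : Fin 4 → Fin 4 → Fin 4 → ℝ) :
    contrVol h η l (fun a b c => X a b c + Y a b c) = contrVol h η l X + contrVol h η l Y := by
  simp only [contrVol, mul_add, Finset.sum_add_distrib]

namespace IsMetricVolume

variable {g h : Mat4} {η : Fin 4 → Fin 4 → Fin 4 → Fin 4 → ℝ}

/-- A cyclic permutation of three indices is even, so the three terms of an exterior derivative
contribute equally. -/
theorem contrVol_cycle (H : IsMetricVolume g h η) (l : Fin 4) (X : Fin 4 → Fin 4 → Fin 4 → ℝ) :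
    contrVol h η l (fun a b c => X b c a) = contrVol h η l X := by
  unfold contrVol
  rw [sum_cycle]
  refine Finset.sum_congr rfl fun i _ => Finset.sum_congr rfl fun j _ =>
    Finset.sum_congr rfl fun k _ => ?_
  conv_rhs => rw [sum_cycle, sum_cycle]
  rw [H.swap₀ i k j l, H.swap₁ i j k l, neg_neg]
  congr 1
  exact Finset.sum_congr rfl fun a _ => Finset.sum_congr rfl fun b _ =>
    Finset.sum_congr rfl fun c _ => by ring

/-- Since $\eta_{ijkl}=\eta_{iljk}$, the sum over `j, k` is the Hodge dual of `D a`, up to its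
factor $\frac12$. -/
theorem contrVol_eq (H : IsMetricVolume g h η) (l : Fin 4) (D : Fin 4 → Mat4) :
    contrVol h η l (fun a b c => D a b c) = 2 * ∑ i, ∑ a, h i a * dual h η (D a) i l := by
  have e : ∀ i, ∑ j, ∑ k, η i j k l * ∑ a, ∑ b, ∑ c, (h i a * h j b * h k c) * D a b c
      = ∑ a, h i a * ∑ j, ∑ k, η i l j k * raise h (D a) j k := by
    intro i
    simp only [raise, Matrix.of_apply, Finset.mul_sum]
    conv_rhs =>
      rw [Finset.sum_comm]
      enter [2, j]
      rw [Finset.sum_comm]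
    refine Finset.sum_congr rfl fun j _ => Finset.sum_congr rfl fun k _ =>
      Finset.sum_congr rfl fun a _ => Finset.sum_congr rfl fun b _ =>
      Finset.sum_congr rfl fun c _ => ?_
    rw [H.swap₁ i j l k, H.swap₂ i j k l]; ring
  simp only [contrVol, e]
  simp only [dual_apply, Finset.mul_sum]
  exact Finset.sum_congr rfl fun _ _ => Finset.sum_congr rfl fun _ _ =>
    Finset.sum_congr rfl fun _ _ => Finset.sum_congr rfl fun _ _ => by ring

end IsMetricVolume

namespace IsLocalSpacetime

variable {g : E4 → Mat4} {η : E4 → Fin 4 → Fin 4 → Fin 4 → Fin 4 → ℝ} {y : E4} {A : E4 → Mat4}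

/-- The exterior derivative of a 2-form is the cyclic sum of its covariant derivative. -/
theorem extd_eq (L : IsLocalSpacetime g η y) (hA : ∀ i j, A y j i = -A y i j) (i j k : Fin 4) :
    extd A y i j k = nablaM g A y i j k + nablaM g A y j k i + nablaM g A y k i j := by
  -- The connection is torsion-free and `A` is skew, so the connection terms of the cyclic sum
  -- cancel in pairs.
  have e1 : ∑ l, christoffel g y l j i * A y k l = -∑ l, christoffel g y l i j * A y l k := by
    rw [← Finset.sum_neg_distrib]
    exact Finset.sum_congr rfl fun l _ => by rw [hA l k, L.christoffel_symm l j i]; ring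
  have e2 : ∑ l, christoffel g y l k j * A y i l = -∑ l, christoffel g y l j k * A y l i := by
    rw [← Finset.sum_neg_distrib]
    exact Finset.sum_congr rfl fun l _ => by rw [hA l i, L.christoffel_symm l k j]; ring
  have e3 : ∑ l, christoffel g y l i k * A y j l = -∑ l, christoffel g y l k i * A y l j := by
    rw [← Finset.sum_neg_distrib]
    exact Finset.sum_congr rfl fun l _ => by rw [hA l j, L.christoffel_symm l i k]; ring
  simp only [extd, nablaM, nabla, Matrix.of_apply, smul_eq_mul, e1, e2, e3]
  ring

theorem pdM_antisymm (hA : ∀ᶠ z in nhds y, ∀ i j, A z j i = -A z i j) (k i j : Fin 4) :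
    pdM k A y j i = -pdM k A y i j := by
  simp only [pdM, Matrix.of_apply]
  rw [pd_congr k (f' := fun z => -A z i j) (hA.mono fun z hz => hz i j)]
  simp [pd]

theorem nablaM_antisymm (hA : ∀ᶠ z in nhds y, ∀ i j, A z j i = -A z i j) (k i j : Fin 4) :
    nablaM g A y k j i = -nablaM g A y k i j := by
  have ha := hA.self_of_nhds
  have e : ∀ i j, ((christoffelM g y k).transpose * A y) j i = -(A y * christoffelM g y k) i j := by
    intro i j
    simp only [Matrix.mul_apply, Matrix.transpose_apply, ← Finset.sum_neg_distrib]
    exact Finset.sum_congr rfl fun l _ => by rw [ha i l]; ring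
  have e2 : (A y * christoffelM g y k) j i = -((christoffelM g y k).transpose * A y) i j := by
    rw [e j i, neg_neg]
  rw [nablaM_eq, Matrix.sub_apply, Matrix.sub_apply, Matrix.sub_apply, Matrix.sub_apply,
    pdM_antisymm hA, e i j, e2]
  ring

/-- The codifferential of a 2-form is the negative of its divergence. -/
theorem codiff_eq (L : IsLocalSpacetime g η y) (hA : DiffM A y)
    (ha : ∀ᶠ z in nhds y, ∀ i j, A z j i = -A z i j) :
    codiff g η A y = -divergence (g y)⁻¹ (nablaM g A y) := by
  have H := L.isMetricVolume
  funext l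
  have e1 : codiff g η A y l = (1 / 6) * contrVol (g y)⁻¹ (η y) l fun i j k =>
      extd (star g η A) y i j k := rfl
  have e2 : ∀ i j k, extd (star g η A) y i j k
      = dual (g y)⁻¹ (η y) (nablaM g A y i) j k + dual (g y)⁻¹ (η y) (nablaM g A y j) k i
        + dual (g y)⁻¹ (η y) (nablaM g A y k) i j := by
    intro i j k
    rw [star_eq_dual, L.extd_eq (fun i j => H.dual_antisymm _ i j), L.nablaM_dual hA,
      L.nablaM_dual hA, L.nablaM_dual hA]
  set D : Fin 4 → Mat4 := fun a => dual (g y)⁻¹ (η y) (nablaM g A y a) with hD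
  have c1 := H.contrVol_cycle l fun a b c => D a b c
  have c2 := H.contrVol_cycle l fun a b c => D b c a
  rw [e1]
  simp only [e2]
  rw [contrVol_add _ _ l (fun i j k => D i j k + D j k i) (fun i j k => D k i j),
    contrVol_add _ _ l (fun i j k => D i j k) (fun i j k => D j k i), c2, c1, H.contrVol_eq]
  -- The two stars in $\delta=*d*$ meet on $\nabla A$ and produce the sign; the constants combine as
  -- $\frac16\cdot3\cdot2=1$.
  have dd : ∀ a, dual (g y)⁻¹ (η y) (D a) = -nablaM g A y a := fun a =>
    H.dual_dual (nablaM_antisymm ha a)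
  simp only [dd, Matrix.neg_apply, Pi.neg_apply, divergence, mul_neg, Finset.sum_neg_distrib]
  rw [Finset.sum_comm]
  have : ∑ k, ∑ a, (g y)⁻¹ k a * nablaM g A y k a l = ∑ a, ∑ k, (g y)⁻¹ k a * nablaM g A y a k l := by
    exact Finset.sum_congr rfl fun k _ => Finset.sum_congr rfl fun a _ => by rw [H.inv_symm k a]
  rw [this]; ring

end IsLocalSpacetime

section Map

variable {F F' : Type} [NormedField F] [NormedAlgebra ℝ F] [NormedField F'] [NormedAlgebra ℝ F']
  {g : E4 → Mat4} {η : E4 → Fin 4 → Fin 4 → Fin 4 → Fin 4 → ℝ} {y : E4}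
  {A : E4 → Fin 4 → Fin 4 → F}

/-- The operators have real coefficients and so commute with real-linear maps. Applied to
`Complex.reCLM` and `Complex.imCLM`, this and its analogues reduce the complex $\delta$ and $\nabla$
to real ones. -/
theorem star_map (ℓ : F →L[ℝ] F') (g : E4 → Mat4) (η : E4 → Fin 4 → Fin 4 → Fin 4 → Fin 4 → ℝ)
    (A : E4 → Fin 4 → Fin 4 → F) :
    star g η (fun z i j => ℓ (A z i j)) = fun z i j => ℓ (star g η A z i j) := by
  funext z i j
  simp only [star, map_smul, map_sum]

theorem nabla_map (ℓ : F →L[ℝ] F') (hA : ∀ i j, DifferentiableAt ℝ (fun z => A z i j) y)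
    (k i j : Fin 4) :
    nabla g (fun z i j => ℓ (A z i j)) y k i j = ℓ (nabla g A y k i j) := by
  simp only [nabla, map_sub, map_smul, map_sum, pd_clm k ℓ (hA i j)]

theorem IsLocalSpacetime.differentiableAt_star (L : IsLocalSpacetime g η y)
    (hA : ∀ i j, DifferentiableAt ℝ (fun z => A z i j) y) (i j : Fin 4) :
    DifferentiableAt ℝ (fun z => star g η A z i j) y := by
  have d : ∀ k l m n, DifferentiableAt ℝ
      (fun z => ((g z)⁻¹ k m * (g z)⁻¹ l n) • A z m n) y := fun k l m n =>
    ((L.diffM_inv k m).fun_mul (L.diffM_inv l n)).fun_smul (hA m n)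
  have d' : ∀ k l, DifferentiableAt ℝ
      (fun z => η z i j k l • ∑ m, ∑ n, ((g z)⁻¹ k m * (g z)⁻¹ l n) • A z m n) y := fun k l =>
    (L.pd_vol 0 i j k l).1.fun_smul (DifferentiableAt.fun_sum fun m _ =>
      DifferentiableAt.fun_sum fun n _ => d k l m n)
  exact DifferentiableAt.fun_const_smul (DifferentiableAt.fun_sum fun k _ =>
    DifferentiableAt.fun_sum fun l _ => d' k l) _

theorem IsLocalSpacetime.codiff_map (L : IsLocalSpacetime g η y) (ℓ : F →L[ℝ] F')
    (hA : ∀ i j, DifferentiableAt ℝ (fun z => A z i j) y) (j : Fin 4) :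
    codiff g η (fun z i j => ℓ (A z i j)) y j = ℓ (codiff g η A y j) := by
  have d := L.differentiableAt_star hA
  simp only [codiff, star3, extd, star_map, map_smul, map_sum, map_add]
  simp only [pd_clm _ ℓ (d _ _)]

end Map

end Coord

/-! ### Real and imaginary parts of $\Sigma[U]$; the equivalence in a chart. -/

namespace Coord

section SelfDual

variable {g : E4 → Mat4} {η : E4 → Fin 4 → Fin 4 → Fin 4 → Fin 4 → ℝ} {y : E4} {U : E4 → Mat4}

theorem selfDual_re (g : E4 → Mat4) (η : E4 → Fin 4 → Fin 4 → Fin 4 → Fin 4 → ℝ) (U : E4 → Mat4) :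
    (fun z i j => Complex.reCLM (selfDual g η U z i j))
      = fun z i j => ((1 / Real.sqrt 2) • ContinuousLinearMap.id ℝ ℝ) (U z i j) := by
  funext z i j
  have : selfDual g η U z i j = ((1 / Real.sqrt 2 : ℝ) : ℂ) *
      ((U z i j : ℂ) - Complex.I * ((star g η U z i j : ℝ) : ℂ)) := by
    rw [Complex.ofReal_div, Complex.ofReal_one]; rfl
  rw [this]
  generalize 1 / Real.sqrt 2 = r
  simp

theorem selfDual_im (g : E4 → Mat4) (η : E4 → Fin 4 → Fin 4 → Fin 4 → Fin 4 → ℝ) (U : E4 → Mat4) :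
    (fun z i j => Complex.imCLM (selfDual g η U z i j))
      = fun z i j => ((-(1 / Real.sqrt 2)) • ContinuousLinearMap.id ℝ ℝ) (star g η U z i j) := by
  funext z i j
  have : selfDual g η U z i j = ((1 / Real.sqrt 2 : ℝ) : ℂ) *
      ((U z i j : ℂ) - Complex.I * ((star g η U z i j : ℝ) : ℂ)) := by
    rw [Complex.ofReal_div, Complex.ofReal_one]; rfl
  rw [this]
  generalize 1 / Real.sqrt 2 = r
  simp

theorem IsLocalSpacetime.differentiableAt_selfDual (L : IsLocalSpacetime g η y) (hU : DiffM U y)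
    (i j : Fin 4) : DifferentiableAt ℝ (fun z => selfDual g η U z i j) y := by
  have h1 : DifferentiableAt ℝ (fun z => ((U z i j : ℝ) : ℂ)) y :=
    Complex.ofRealCLM.differentiableAt.comp y (hU i j)
  have h2 : DifferentiableAt ℝ (fun z => ((star g η U z i j : ℝ) : ℂ)) y :=
    Complex.ofRealCLM.differentiableAt.comp y (L.differentiableAt_star hU i j)
  exact (h1.fun_sub (h2.const_mul _)).const_mul _

theorem IsLocalSpacetime.nabla_selfDual (L : IsLocalSpacetime g η y) (hU : DiffM U y)
    (k i j : Fin 4) :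
    (nabla g (selfDual g η U) y k i j).re = 1 / Real.sqrt 2 * nablaM g U y k i j ∧
    (nabla g (selfDual g η U) y k i j).im
      = -(1 / Real.sqrt 2) * nablaM g (starM g η U) y k i j := by
  have d := L.differentiableAt_selfDual hU
  constructor
  · rw [← Complex.reCLM_apply, ← nabla_map _ d, selfDual_re, nabla_map _ hU]
    rfl
  · rw [← Complex.imCLM_apply, ← nabla_map _ d, selfDual_im,
      nabla_map _ (L.differentiableAt_star hU)]
    rfl

theorem IsLocalSpacetime.codiff_selfDual (L : IsLocalSpacetime g η y) (hU : DiffM U y)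
    (j : Fin 4) :
    (codiff g η (selfDual g η U) y j).re = 1 / Real.sqrt 2 * codiff g η U y j ∧
    (codiff g η (selfDual g η U) y j).im = -(1 / Real.sqrt 2) * codiff g η (starM g η U) y j := by
  have d := L.differentiableAt_selfDual hU
  constructor
  · rw [← Complex.reCLM_apply, ← L.codiff_map _ d, selfDual_re, L.codiff_map _ hU]
    rfl
  · rw [← Complex.imCLM_apply, ← L.codiff_map _ d, selfDual_im,
      L.codiff_map _ (L.differentiableAt_star hU)]
    rfl

/-- The real and the imaginary part of `Σ[U]`. -/
theorem IsLocalSpacetime.sigma_re_im (L : IsLocalSpacetime g η y) (hU : DiffM U y)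
    (k i j : Fin 4) :
    (sigma g η U y k i j).re = 1 / Real.sqrt 2 * (nablaM g U y k
        - (1 / 2 : ℝ) • (phiForm g η U y k • U y + psiForm g η U y k • starM g η U y)
        - (1 / 2 : ℝ) • cform (g y) (η y) (Matrix.mulVec (g y)⁻¹ (codiff g η U y))
          (-Matrix.mulVec (g y)⁻¹ (codiff g η (starM g η U) y)) k : Mat4) i j ∧
    (sigma g η U y k i j).im = -(1 / Real.sqrt 2) * (nablaM g (starM g η U) y k
        - (1 / 2 : ℝ) • (phiForm g η U y k • starM g η U y - psiForm g η U y k • U y)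
        - (1 / 2 : ℝ) • cform (g y) (η y) (Matrix.mulVec (g y)⁻¹ (codiff g η (starM g η U) y))
          (Matrix.mulVec (g y)⁻¹ (codiff g η U y)) k : Mat4) i j := by
  set r : ℝ := 1 / Real.sqrt 2 with hr
  have hr2 : r * r = 1 / 2 := by
    rw [hr, div_mul_div_comm, Real.mul_self_sqrt (by norm_num)]; norm_num
  set p := codiff g η U y with hp
  set q := codiff g η (starM g η U) y with hq
  have sre : ∀ i j, (selfDual g η U y i j).re = r * U y i j := fun i j =>
    congrFun (congrFun (congrFun (selfDual_re g η U) y) i) j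
  have sim : ∀ i j, (selfDual g η U y i j).im = -r * starM g η U y i j := fun i j =>
    congrFun (congrFun (congrFun (selfDual_im g η U) y) i) j
  set v : Fin 4 → ℂ := fun l => ∑ a, (g y)⁻¹ l a • codiff g η (selfDual g η U) y a with hv
  have vre : ∀ l, (v l).re = r * Matrix.mulVec (g y)⁻¹ p l := by
    intro l
    simp only [hv, Complex.re_sum, Complex.real_smul, Complex.re_ofReal_mul,
      (L.codiff_selfDual hU _).1, Matrix.mulVec, dotProduct, Finset.mul_sum]
    exact Finset.sum_congr rfl fun a _ => by ring
  have vim : ∀ l, (v l).im = -r * Matrix.mulVec (g y)⁻¹ q l := by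
    intro l
    simp only [hv, Complex.im_sum, Complex.real_smul, Complex.im_ofReal_mul,
      (L.codiff_selfDual hU _).2, Matrix.mulVec, dotProduct, Finset.mul_sum]
    exact Finset.sum_congr rfl fun a _ => by ring
  have hint : interior (g y)⁻¹ (codiff g η (selfDual g η U) y) (selfDual g η U y) k
      = ∑ l, v l * selfDual g η U y l k := rfl
  have hΦ : phiForm g η U y k = ∑ l, (Matrix.mulVec (g y)⁻¹ p l * U y l k
      - Matrix.mulVec (g y)⁻¹ q l * starM g η U y l k) := by
    rw [Finset.sum_sub_distrib]; rfl
  have hΨ : psiForm g η U y k = -∑ l, (Matrix.mulVec (g y)⁻¹ p l * starM g η U y l k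
      + Matrix.mulVec (g y)⁻¹ q l * U y l k) := by
    rw [Finset.sum_add_distrib, neg_add]; rfl
  -- Together with `iim` this is $i(\delta\mathcal U)\,\mathcal U=\frac12(\Phi+\mathrm i\Psi)$, the
  -- $\frac12$ being the product of two factors $1/\sqrt2$.
  have ire : (∑ l, v l * selfDual g η U y l k).re = 1 / 2 * phiForm g η U y k := by
    rw [hΦ, Complex.re_sum, Finset.mul_sum, ← hr2]
    exact Finset.sum_congr rfl fun l _ => by rw [Complex.mul_re, vre, vim, sre, sim]; ring
  have iim : (∑ l, v l * selfDual g η U y l k).im = 1 / 2 * psiForm g η U y k := by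
    rw [hΨ, Complex.im_sum, ← Finset.sum_neg_distrib, Finset.mul_sum, ← hr2]
    exact Finset.sum_congr rfl fun l _ => by rw [Complex.mul_im, vre, vim, sre, sim]; ring
  have mre : ∀ l, (selfDualMetric g η y l k i j).re = 1 / 2 * biform (g y) l k i j := by
    intro l
    simp [selfDualMetric, biform]
  have mim : ∀ l, (selfDualMetric g η y l k i j).im = -(1 / 2) * volform (η y) l k i j := by
    intro l
    simp [selfDualMetric, volform]
  have cf : ∀ b κ : Fin 4 → ℝ, cform (g y) (η y) b κ k i j
      = ∑ l, (b l * biform (g y) l k i j + κ l * volform (η y) l k i j) := by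
    intro b κ
    simp [cform, Matrix.add_apply, Matrix.sum_apply, Finset.sum_add_distrib]
  have gre : (∑ l, v l * selfDualMetric g η y l k i j).re
      = r * (1 / 2 * cform (g y) (η y) (Matrix.mulVec (g y)⁻¹ p)
          (-Matrix.mulVec (g y)⁻¹ q) k i j) := by
    rw [cf, Complex.re_sum, Finset.mul_sum, Finset.mul_sum]
    exact Finset.sum_congr rfl fun l _ => by
      rw [Complex.mul_re, vre, vim, mre, mim, Pi.neg_apply]; ring
  have gim : (∑ l, v l * selfDualMetric g η y l k i j).im
      = -r * (1 / 2 * cform (g y) (η y) (Matrix.mulVec (g y)⁻¹ q)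
          (Matrix.mulVec (g y)⁻¹ p) k i j) := by
    rw [cf, Complex.im_sum, Finset.mul_sum, Finset.mul_sum]
    exact Finset.sum_congr rfl fun l _ => by
      rw [Complex.mul_im, vre, vim, mre, mim]; ring
  have hs : sigma g η U y k i j = nabla g (selfDual g η U) y k i j
      - (∑ l, v l * selfDual g η U y l k) * selfDual g η U y i j
      - ∑ l, v l * selfDualMetric g η y l k i j := rfl
  simp only [Matrix.sub_apply, Matrix.add_apply, Matrix.smul_apply, smul_eq_mul]
  constructor
  · rw [hs, Complex.sub_re, Complex.sub_re, Complex.mul_re, gre, ire, iim, sre, sim,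
      (L.nabla_selfDual hU k i j).1]
    ring
  · rw [hs, Complex.sub_im, Complex.sub_im, Complex.mul_im, gim, ire, iim, sre, sim,
      (L.nabla_selfDual hU k i j).2]
    ring

end SelfDual

namespace IsLocalSpacetime

variable {g : E4 → Mat4} {η : E4 → Fin 4 → Fin 4 → Fin 4 → Fin 4 → ℝ} {y : E4} {U : E4 → Mat4}

theorem contr_comm {h : Mat4} (hs : ∀ i j, h i j = h j i) (A B : Mat4) :
    contr h A B = contr h B A := by
  have ht : h.transpose = h := by ext i j; exact hs j i
  rw [contr_eq_trace, contr_eq_trace, raise_eq_mul hs, raise_eq_mul hs,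
    ← Matrix.trace_transpose]
  simp only [Matrix.transpose_mul, Matrix.transpose_transpose, ht]
  rw [← mul_assoc, Matrix.trace_mul_comm, ← mul_assoc, ← mul_assoc, ← mul_assoc]

/-- The two contraction relations come from differentiating the constants $(U,U)=-2$ and
$(U,{*U})=0$; for the second, self-adjointness of the parallel dual makes both Leibniz terms equal
to $({*U},\nabla U)$. -/
theorem unitaryJet (L : IsLocalSpacetime g η y) (hU : DiffM U y)
    (hu : ∀ᶠ z in nhds y, IsUnitaryForm (g z) (g z)⁻¹ (η z) (U z) (starM g η U z)) :
    UnitaryJet (g y) (g y)⁻¹ (η y) (U y) (starM g η U y) (nablaM g U y)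
      (nablaM g (starM g η U) y) := by
  have H := L.isMetricVolume
  have dw : DiffM (starM g η U) y := L.diffM_dual hU
  have hN : ∀ k, dual (g y)⁻¹ (η y) (nablaM g U y k) = nablaM g (starM g η U) y k := fun k =>
    (L.nablaM_dual hU k).symm
  have c1 : ∀ k, pd k (fun z => contr (g z)⁻¹ (U z) (U z)) y = 0 := by
    intro k
    rw [pd_congr k (f' := fun _ => (-2 : ℝ)) ((hu.and L.eventually_isMetricVolume).mono
      fun z hz => hz.1.contr_form_form hz.2.1), pd_const]
  have c2 : ∀ k, pd k (fun z => contr (g z)⁻¹ (U z) (starM g η U z)) y = 0 := by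
    intro k
    rw [pd_congr k (f' := fun _ => (0 : ℝ)) ((hu.and L.eventually_isMetricVolume).mono
      fun z hz => hz.1.contr_form_dual hz.2.1), pd_const]
  refine ⟨hu.self_of_nhds, nablaM_antisymm (hu.mono fun z hz => hz.antisymm), hN,
    fun k => ?_, fun k => ?_⟩
  · have := c1 k
    rw [L.pd_contr hU hU, contr_comm H.inv_symm (nablaM g U y k)] at this
    linarith
  · have := c2 k
    rw [L.pd_contr hU dw, contr_comm H.inv_symm (nablaM g U y k), ← hN, H.contr_dual,
      hu.self_of_nhds.dual_form] at this
    linarith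

theorem sigma_eq_zero_iff (L : IsLocalSpacetime g η y) (hU : DiffM U y)
    (hu : ∀ᶠ z in nhds y, IsUnitaryForm (g z) (g z)⁻¹ (η z) (U z) (starM g η U z)) :
    (∀ k i j, sigma g η U y k i j = 0) ↔ ∀ k, nablaM g U y k
        - (1 / 2 : ℝ) • (phiForm g η U y k • U y + psiForm g η U y k • starM g η U y)
        - (1 / 2 : ℝ) • cform (g y) (η y) (Matrix.mulVec (g y)⁻¹ (codiff g η U y))
          (-Matrix.mulVec (g y)⁻¹ (codiff g η (starM g η U) y)) k = 0 := by
  have H := L.isMetricVolume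
  have J := L.unitaryJet hU hu
  have hr : 1 / Real.sqrt 2 ≠ 0 := by positivity
  constructor
  · intro h k
    ext i j
    have := (L.sigma_re_im hU k i j).1
    rw [h k i j, Complex.zero_re] at this
    exact (mul_eq_zero.1 this.symm).resolve_left hr
  · intro h k i j
    -- The Hodge dual of the real equation is the imaginary one, so the real part suffices.
    have hd := congrArg (dual (g y)⁻¹ (η y)) (h k)
    simp only [map_sub, map_smul, map_add, J.dual_deriv, J.dual_form,
      J.toIsUnitaryForm.dual_dual_form H, H.dual_cform, map_zero, neg_neg, smul_neg,
      ← sub_eq_add_neg] at hd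
    apply Complex.ext
    · rw [(L.sigma_re_im hU k i j).1, h k]; simp
    · rw [(L.sigma_re_im hU k i j).2, hd]; simp

/-- The covariant derivative of a 2-form with canonical elements `(U, φ, ψ)`. -/
theorem nablaM_canonical (L : IsLocalSpacetime g η y) (hU : DiffM U y)
    (hu : ∀ᶠ z in nhds y, IsUnitaryForm (g z) (g z)⁻¹ (η z) (U z) (starM g η U z))
    {φ ψ : E4 → ℝ} (hφ : DifferentiableAt ℝ φ y) (hψ : DifferentiableAt ℝ ψ y) {A : E4 → Mat4}
    (hA : ∀ᶠ z in nhds y, ∀ i j, A z i j = Real.exp (φ z) *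
      (Real.cos (ψ z) * U z i j + Real.sin (ψ z) * starM g η U z i j)) :
    DiffM A y ∧ nablaM g A y = fun k => Real.exp (φ y) • (Real.cos (ψ y) •
      (nablaM g U y k + pd k φ y • U y + pd k ψ y • starM g η U y)
      + Real.sin (ψ y) • dual (g y)⁻¹ (η y)
      (nablaM g U y k + pd k φ y • U y + pd k ψ y • starM g η U y)) := by
  have H := L.isMetricVolume
  have J := L.unitaryJet hU hu
  have dw : DiffM (starM g η U) y := L.diffM_dual hU
  have hc : DifferentiableAt ℝ (fun z => Real.cos (ψ z)) y := hψ.cos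
  have hs : DifferentiableAt ℝ (fun z => Real.sin (ψ z)) y := hψ.sin
  have he : DifferentiableAt ℝ (fun z => Real.exp (φ z)) y := hφ.exp
  have hev : ∀ i j, (fun z => A z i j) =ᶠ[nhds y] fun z => Real.exp (φ z) *
      (Real.cos (ψ z) * U z i j + Real.sin (ψ z) * starM g η U z i j) := fun i j =>
    hA.mono fun z hz => hz i j
  have d1 : ∀ i j, DifferentiableAt ℝ
      (fun z => Real.cos (ψ z) * U z i j + Real.sin (ψ z) * starM g η U z i j) y := fun i j =>
    (hc.fun_mul (hU i j)).fun_add (hs.fun_mul (dw i j))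
  refine ⟨fun i j => (he.fun_mul (d1 i j)).congr_of_eventuallyEq (hev i j), ?_⟩
  have hy : A y = Real.exp (φ y) • (Real.cos (ψ y) • U y
      + Real.sin (ψ y) • starM g η U y) := by
    ext i j
    exact hA.self_of_nhds i j
  have pexp : ∀ k, pd k (fun z => Real.exp (φ z)) y = Real.exp (φ y) * pd k φ y := by
    intro k; simp [pd, fderiv_exp hφ]
  have pcos : ∀ k, pd k (fun z => Real.cos (ψ z)) y = -Real.sin (ψ y) * pd k ψ y := by
    intro k; simp [pd, fderiv_cos hψ]
  have psin : ∀ k, pd k (fun z => Real.sin (ψ z)) y = Real.cos (ψ y) * pd k ψ y := by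
    intro k; simp [pd, fderiv_sin hψ]
  funext k
  have hpd : pdM k A y = Real.exp (φ y) • (pd k φ y • (Real.cos (ψ y) • U y
      + Real.sin (ψ y) • starM g η U y) + Real.cos (ψ y) • pdM k U y
      + Real.sin (ψ y) • pdM k (starM g η U) y + pd k ψ y • (Real.cos (ψ y) • starM g η U y
      - Real.sin (ψ y) • U y)) := by
    ext i j
    simp only [pdM, Matrix.of_apply, Matrix.smul_apply, Matrix.add_apply, Matrix.sub_apply,
      smul_eq_mul]
    rw [pd_congr k (hev i j), pd_mul k he (d1 i j), pd_add k (hc.fun_mul (hU i j))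
      (hs.fun_mul (dw i j)), pd_mul k hc (hU i j), pd_mul k hs (dw i j), pexp, pcos, psin]
    ring
  have hM := J.dual_deriv k
  simp only [map_add, map_smul, hM, J.dual_form, J.toIsUnitaryForm.dual_dual_form H]
  rw [nablaM_eq, nablaM_eq, nablaM_eq, hpd, hy]
  simp only [mul_add, add_mul, mul_smul_comm, smul_mul_assoc]
  module

/-- The characterization of the conformal Killing-Yano equation at a point of a coordinate
domain. -/
theorem ckyDefect_iff (L : IsLocalSpacetime g η y) (hU : DiffM U y)
    (hu : ∀ᶠ z in nhds y, IsUnitaryForm (g z) (g z)⁻¹ (η z) (U z) (starM g η U z))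
    {φ ψ : E4 → ℝ} (hφ : DifferentiableAt ℝ φ y) (hψ : DifferentiableAt ℝ ψ y) {A : E4 → Mat4}
    (hA : ∀ᶠ z in nhds y, ∀ i j, A z i j = Real.exp (φ z) *
      (Real.cos (ψ z) * U z i j + Real.sin (ψ z) * starM g η U z i j)) :
    (∀ i j k, ckyDefect g η A y i j k = 0) ↔
      (∀ k i j, sigma g η U y k i j = 0) ∧ (∀ k, -2 * pd k φ y = phiForm g η U y k) ∧
        ∀ k, -2 * pd k ψ y = psiForm g η U y k := by
  have H := L.isMetricVolume
  have J := L.unitaryJet hU hu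
  obtain ⟨dA, nA⟩ := L.nablaM_canonical hU hu hφ hψ hA
  have dw : DiffM (starM g η U) y := L.diffM_dual hU
  have anti_w : ∀ᶠ z in nhds y, ∀ i j, starM g η U z j i = -starM g η U z i j :=
    (hu.and L.eventually_isMetricVolume).mono fun z hz => hz.1.dual_antisymm hz.2.1
  have anti_u : ∀ᶠ z in nhds y, ∀ i j, U z j i = -U z i j := hu.mono fun z hz => hz.antisymm
  have anti_A : ∀ᶠ z in nhds y, ∀ i j, A z j i = -A z i j := by
    filter_upwards [hA, anti_u, anti_w] with z h1 h2 h3 i j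
    rw [h1, h1, h2 i j, h3 i j]; ring
  have hdef : ∀ i j k, ckyDefect g η A y i j k = defect (g y) (g y)⁻¹ (nablaM g A y) i j k := by
    intro i j k
    simp only [ckyDefect, defect, L.codiff_eq dA anti_A, Pi.neg_apply]
    simp only [nablaM, Matrix.of_apply]
    ring
  simp only [hdef, nA]
  -- The factor $e^\phi$ and the rotation by $\psi$ are stripped off, leaving the algebraic problem
  -- for $N+d\phi\otimes u+d\psi\otimes w$.
  rw [H.defect_rotation_iff _ (Real.exp_ne_zero _) (Real.cos_sq_add_sin_sq _),
    J.eq_cform_iff H (fun k => pd k φ y) (fun k => pd k ψ y) _ _ (phiForm g η U y)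
      (psiForm g η U y) (L.codiff_eq hU anti_u) (L.codiff_eq dw anti_w) rfl rfl,
    L.sigma_eq_zero_iff hU hu, funext_iff, funext_iff]
  · rfl
  · intro k i j
    simp only [Matrix.add_apply, Matrix.smul_apply, smul_eq_mul, J.deriv_antisymm k i j,
      J.antisymm i j, J.toIsUnitaryForm.dual_antisymm H i j]
    ring

end IsLocalSpacetime
end Coord

/-! ### From the manifold to coordinate components. -/

section Chart

variable {M : Type*} [TopologicalSpace M] [ChartedSpace E4 M]

theorem mdifferentiable_of_mem_maximalAtlas [IsManifold (𝓡 4) ∞ M] {e : OpenPartialHomeomorph M E4}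
    (he : e ∈ IsManifold.maximalAtlas (𝓡 4) ∞ M) : e.MDifferentiable (𝓡 4) (𝓡 4) :=
  ⟨(contMDiffOn_of_mem_maximalAtlas he).mdifferentiableOn (by simp),
    (contMDiffOn_symm_of_mem_maximalAtlas he).mdifferentiableOn (by simp)⟩

/-- The coordinate vectors of a chart form a basis of the tangent space. -/
theorem exists_basis_coordVector [IsManifold (𝓡 4) ∞ M] {e : OpenPartialHomeomorph M E4}
    (he : e ∈ IsManifold.maximalAtlas (𝓡 4) ∞ M) {y : E4} (hy : y ∈ e.target) :
    ∃ b : Module.Basis (Fin 4) ℝ (TangentSpace (𝓡 4) (e.symm y)), ⇑b = coordVector e y := by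
  let L := (mdifferentiable_of_mem_maximalAtlas he).symm.mfderiv (x := y) hy
  let b₀ : Module.Basis (Fin 4) ℝ (TangentSpace (𝓡 4) y) :=
    (EuclideanSpace.basisFun (Fin 4) ℝ).toBasis
  refine ⟨b₀.map L.toLinearEquiv, ?_⟩
  funext i
  have : b₀ i = (EuclideanSpace.single i (1 : ℝ) : E4) := by
    change (EuclideanSpace.basisFun (Fin 4) ℝ).toBasis i = EuclideanSpace.single i (1 : ℝ)
    rw [OrthonormalBasis.coe_toBasis, EuclideanSpace.basisFun_apply]
  rw [Module.Basis.map_apply, this]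
  rfl

namespace OrientedSpacetime

variable (S : OrientedSpacetime M)

/-- A top-degree form vanishing on one basis vanishes identically, whereas on a Lorentz-orthonormal
basis `vol_sq` makes its square equal to 1. -/
theorem vol_basis_ne_zero {x : M} (b : Module.Basis (Fin 4) ℝ (TangentSpace (𝓡 4) x)) :
    S.vol x b ≠ 0 := by
  intro h0
  obtain ⟨b', hb'⟩ := S.metric_lorentzian x
  have h1 : S.vol x b' = 0 := by
    rw [(S.vol x).eq_smul_basis_det b, h0, zero_smul]
    rfl
  have h2 := S.vol_sq x b'
  have h3 : (Matrix.of fun i j => S.metric x (b' i) (b' j))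
      = Matrix.diagonal fun i : Fin 4 => if i = 0 then (-1 : ℝ) else 1 := by
    ext i j
    rw [Matrix.of_apply, hb', Matrix.diagonal_apply]
  rw [h1, h3, Matrix.det_diagonal] at h2
  simp at h2

theorem volComp_eq_levi [IsManifold (𝓡 4) ∞ M] {e : OpenPartialHomeomorph M E4}
    (he : e ∈ IsManifold.maximalAtlas (𝓡 4) ∞ M) {y : E4} (hy : y ∈ e.target)
    (i j k l : Fin 4) :
    S.volComp e y i j k l
      = S.vol (e.symm y) (coordVector e y) * Coord.levi ![i, j, k, l] := by
  obtain ⟨b, hb⟩ := exists_basis_coordVector he hy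
  have hv : ![coordVector e y i, coordVector e y j, coordVector e y k, coordVector e y l]
      = b ∘ ![i, j, k, l] := by
    rw [hb]
    funext r
    fin_cases r <;> rfl
  rw [volComp, hv, (S.vol (e.symm y)).eq_smul_basis_det b, ← hb]
  simp only [AlternatingMap.smul_apply, smul_eq_mul, Module.Basis.det_self, mul_one]
  congr 1
  rw [Module.Basis.det_apply, Coord.levi, ← Matrix.det_transpose]
  congr 1
  ext r c
  simp [Module.Basis.toMatrix_apply, Matrix.one_apply, Finsupp.single_apply]

theorem isLocalSpacetime [IsManifold (𝓡 4) ∞ M] {e : OpenPartialHomeomorph M E4}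
    (he : e ∈ IsManifold.maximalAtlas (𝓡 4) ∞ M) {y : E4} (hy : y ∈ e.target) :
    Coord.IsLocalSpacetime (S.metricComp e) (S.volComp e) y := by
  have hn : e.target ∈ nhds y := e.open_target.mem_nhds hy
  refine ⟨fun i j => ((S.metric_smooth e he i j).contDiffAt hn).differentiableAt (by simp),
    Filter.Eventually.of_forall fun z i j => S.metric_symm _ _ _,
    fun z => S.vol (e.symm z) (coordVector e z),
    ((S.vol_smooth e he).contDiffAt hn).differentiableAt (by simp), ?_⟩
  filter_upwards [hn] with z hz
  obtain ⟨b, hb⟩ := exists_basis_coordVector he hz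
  refine ⟨S.vol_sq _ _, ?_, S.volComp_eq_levi he hz⟩
  rw [← hb]
  exact S.vol_basis_ne_zero b

/-- Raising the index of $g(b,\partial_j)$ recovers the coordinates of $b$ in the basis
$\partial_i$. This carries the normalization of the pair `(t, s)` over to components. -/
theorem sum_inv_metricComp [IsManifold (𝓡 4) ∞ M] {e : OpenPartialHomeomorph M E4}
    (he : e ∈ IsManifold.maximalAtlas (𝓡 4) ∞ M) {y : E4} (hy : y ∈ e.target)
    (a b : TangentSpace (𝓡 4) (e.symm y)) :
    ∑ i, S.metric (e.symm y) a (coordVector e y i) *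
      ∑ j, (S.metricComp e y)⁻¹ i j * S.metric (e.symm y) b (coordVector e y j)
        = S.metric (e.symm y) a b := by
  obtain ⟨c, hc⟩ := exists_basis_coordVector he hy
  have H := (S.isLocalSpacetime he hy).isMetricVolume
  have e1 : ∀ i, ∑ j, (S.metricComp e y)⁻¹ i j * S.metric (e.symm y) b (coordVector e y j)
      = c.repr b i := by
    intro i
    rw [← H.sum_inv_metric i (c.repr b)]
    refine Finset.sum_congr rfl fun j _ => ?_
    congr 1
    conv_lhs => rw [← c.sum_repr b, S.metric_symm]
    rw [map_sum]
    refine Finset.sum_congr rfl fun m _ => ?_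
    rw [map_smul, smul_eq_mul, mul_comm, hc]
    rfl
  simp only [e1]
  conv_rhs => rw [← c.sum_repr b]
  rw [map_sum]
  refine Finset.sum_congr rfl fun m _ => ?_
  rw [map_smul, smul_eq_mul, mul_comm, hc]

theorem isUnitaryForm_comp [IsManifold (𝓡 4) ∞ M] {e : OpenPartialHomeomorph M E4}
    (he : e ∈ IsManifold.maximalAtlas (𝓡 4) ∞ M) {y : E4} (hy : y ∈ e.target)
    {U : TwoFormField M} (hU : S.IsUnitary U) :
    Coord.IsUnitaryForm (S.metricComp e y) (S.metricComp e y)⁻¹ (S.volComp e y) (U.comp e y)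
      (Coord.starM (S.metricComp e) (S.volComp e) (U.comp e) y) := by
  obtain ⟨t, s, htt, hss, hts, h⟩ := hU (e.symm y)
  refine (S.isLocalSpacetime he hy).isMetricVolume.isUnitaryForm
    (fun i => S.metric (e.symm y) t (coordVector e y i))
    (fun i => S.metric (e.symm y) s (coordVector e y i)) (fun i j => h _ _) ?_ ?_ ?_
  · rw [S.sum_inv_metricComp he hy, htt]
  · rw [S.sum_inv_metricComp he hy, hss]
  · rw [S.sum_inv_metricComp he hy, hts]

end OrientedSpacetime

theorem differentiableAt_comp_symm [IsManifold (𝓡 4) ∞ M] {e : OpenPartialHomeomorph M E4}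
    (he : e ∈ IsManifold.maximalAtlas (𝓡 4) ∞ M) {y : E4} (hy : y ∈ e.target) {φ : M → ℝ}
    (hφ : ContMDiff (𝓡 4) 𝓘(ℝ, ℝ) ∞ φ) : DifferentiableAt ℝ (fun z => φ (e.symm z)) y := by
  have h1 : ContMDiffAt (𝓡 4) (𝓡 4) ∞ e.symm y :=
    (contMDiffOn_symm_of_mem_maximalAtlas he).contMDiffAt (e.open_target.mem_nhds hy)
  have h2 : ContMDiffAt (𝓡 4) 𝓘(ℝ, ℝ) ∞ (φ ∘ e.symm) y := hφ.contMDiffAt.comp y h1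
  exact (h2.mdifferentiableAt (by simp)).differentiableAt

end Chart

theorem mainTheorem6 {M : Type*} [TopologicalSpace M] [ChartedSpace E4 M]
    [IsManifold (𝓡 4) ∞ M] (S : OrientedSpacetime M)
    (A U : TwoFormField M) (φ ψ : M → ℝ) (h : S.IsCanonicalElements A U φ ψ) :
    S.IsConformalKillingYano A ↔
      S.SigmaEqZero U ∧ S.PhiEquation U φ ∧ S.PsiEquation U ψ := by
  -- The equivalence holds separately at each point of each chart, so no gluing is needed.
  have key : ∀ e ∈ IsManifold.maximalAtlas (𝓡 4) ∞ M, ∀ y ∈ e.target,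
      (∀ i j k, Coord.ckyDefect (S.metricComp e) (S.volComp e) (A.comp e) y i j k = 0) ↔
        (∀ k i j, Coord.sigma (S.metricComp e) (S.volComp e) (U.comp e) y k i j = 0) ∧
        (∀ k, -2 * Coord.pd k (fun z => φ (e.symm z)) y
          = Coord.phiForm (S.metricComp e) (S.volComp e) (U.comp e) y k) ∧
        ∀ k, -2 * Coord.pd k (fun z => ψ (e.symm z)) y
          = Coord.psiForm (S.metricComp e) (S.volComp e) (U.comp e) y k := by
    intro e he y hy
    have hn : e.target ∈ nhds y := e.open_target.mem_nhds hy
    exact (S.isLocalSpacetime he hy).ckyDefect_iff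
      (fun i j => ((h.smooth_form e he i j).contDiffAt hn).differentiableAt (by simp))
      (Filter.mem_of_superset hn fun z hz => S.isUnitaryForm_comp he hz h.unitary)
      (differentiableAt_comp_symm he hy h.smooth_phi)
      (differentiableAt_comp_symm he hy h.smooth_psi)
      (Filter.mem_of_superset hn fun z hz i j => h.expression e he z hz i j)
  constructor
  · intro hA
    exact ⟨fun e he y hy => ((key e he y hy).1 (hA e he y hy)).1,
      fun e he y hy => ((key e he y hy).1 (hA e he y hy)).2.1,
      fun e he y hy => ((key e he y hy).1 (hA e he y hy)).2.2⟩
  · rintro ⟨h1, h2, h3⟩ e he y hy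
    exact (key e he y hy).2 ⟨h1 e he y hy, h2 e he y hy, h3 e he y hy⟩

end
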